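/- **Setting.** There are $m$ arms and $T$ rounds, with $mTd\ge 2$. Each arm $i$ has a fixed unknown distribution on $[0,1]^d$ with mean $V_i$; let $V\in[0,1]^{d\times m}$ be the matrix with columns $V_i$. In round $t$ the player chooses, from the history (and possibly extra randomness), a distribution $p_t\in\Delta_m$ (the simplex), draws an arm $i_t\sim p_t$, and observes $v_t\in[0,1]^d$ drawn from the distribution of arm $i_t$, independently of the past. $\|\cdot\|$ is the Euclidean norm, $\mathbf 1_d$ is the all-ones vector and $\bar v=\frac1T\sum_{t=1}^T v_t$. **Regret.** In the problem BwR one is given a concave $f:[0,1]^d\to[0,1]$ with $f(x)-f(y)\le L\|x-y\|$ for all $x,y\in[0,1]^d$, where $L>0$. The average regret is $\mathrm{avg\text{-}regret}_1(T)=\mathrm{OPT}_f-f(\bar v)$, where $\mathrm{OPT}_f$ is the supremum of $\mathbb E[f(\bar v)]$ over all randomized non-anticipating policies. In the problem BwC one is given a convex set $S\subseteq\mathbb R^d$ such that $Vp^*\in S$ for some $p^*\in\Delta_m$. The average regret is $\mathrm{avg\text{-}regret}_2(T)=d(\bar v,S)$, the Euclidean distance. **Confidence bounds.** Let $\mathrm{rad}(\nu,N)=\sqrt{\gamma\nu/N}+\gamma/N$.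 Let $k_{t,i}$ be the number of plays of arm $i$ before round $t$, and let $\hat V_{t,ji}=\frac{1}{k_{t,i}+1}\sum_{s<t,\,i_s=i}v_{s,j}$. Let $H_t$ be the set of matrices $M$ with $$\max\{0,\hat V_{t,ji}-2\,\mathrm{rad}(\hat V_{t,ji},k_{t,i}+1)\}\le M_{ji}\le\min\{1,\hat V_{t,ji}+2\,\mathrm{rad}(\hat V_{t,ji},k_{t,i}+1)\}\quad\text{for all } j,i.$$ **Primal algorithm for a differentiable concave $F$.** In round $t$ choose $$(p_t,M_t)\in\arg\max_{p\in\Delta_m,\,M\in H_t}(Mp)\cdot\nabla F(\bar x_{t-1}),$$ with ties broken arbitrarily from the history, where $\bar x_{t-1}=\frac1{t-1}\sum_{s<t}M_sp_s$ for $t\ge2$ and $\bar x_0\in[0,1]^d$ is arbitrary. Then play an arm drawn from $p_t$. **Smooth approximation.** For concave, $L$-Lipschitz $f$ on $[0,1]^d$ let $f^*(\theta)=\max_{y\in[0,1]^d}\{y\cdot\theta+f(y)\}$ and $$\hat f_\mu(z)=\min_{\|\theta\|\le L}\Big\{f^*(\theta)+\frac{\mu}{2L}\theta\cdot\theta-\theta\cdot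 z\Big\},\qquad \mu=\sqrt{\tfrac dT\log_2(2T)}.$$ For BwC the same formula with $L=1$ is applied to $-d(\cdot,S)$, and the result is denoted $-\hat d_\mu(\cdot,S)$. **Theorem.** There are absolute constants $c_0,C>0$ such that for all $m,d,T$ with $mTd\ge2$, all $\delta\in(0,1)$ and all $c\ge c_0$, with $\gamma=c\log(mTd/\delta)$, the following hold for every instance. 1. (BwR) If the primal algorithm is run on $\hat f_\mu$, then with probability at least $1-\delta$ $$\mathrm{avg\text{-}regret}_1(T)\le C\Big(L\|\mathbf 1_d\|\sqrt{\tfrac{\gamma m}{T}}+L\sqrt{\tfrac{d\log T}{T}}\Big).$$ 2. (BwC) If the primal algorithm is run on $-\hat d_\mu(\cdot,S)$, then with probability at least $1-\delta$ $$\mathrm{avg\text{-}regret}_2(T)\le C\Big(\|\mathbf 1_d\|\sqrt{\tfrac{\gamma m}{T}}+\sqrt{\tfrac{d\log T}{T}}\Big).$$ -/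

import Mathlib

open MeasureTheory

noncomputable section

namespace Bandit

/-- Vectors with `d` real components, with the Euclidean norm. -/
abbrev Vec (d : ℕ) := EuclideanSpace ℝ (Fin d)

/-- The cube `[0,1]^d`. -/
def cube (d : ℕ) : Set (Vec d) := {x | ∀ j, x j ∈ Set.Icc (0 : ℝ) 1}

/-- The all-ones vector. -/
def ones (d : ℕ) : Vec d := WithLp.toLp 2 (fun _ => 1)

/-- The vector `M p` for a `d × m` matrix `M` and a weight vector `p` on the arms. -/
def mixture {m d : ℕ} (M : Matrix (Fin d) (Fin m) ℝ) (p : Fin m → ℝ) : Vec d :=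
  WithLp.toLp 2 (M.mulVec p)

/-- A bandit instance: every arm has a fixed observation distribution on `[0,1]^d`. -/
structure Instance (m d : ℕ) where
  law : Fin m → Measure (Vec d)
  isProb : ∀ i, IsProbabilityMeasure (law i)
  mem_cube : ∀ i, ∀ᵐ v ∂(law i), v ∈ cube d

/-- The matrix of means: column `i` is the mean observation of arm `i`. -/
def Instance.mean {m d : ℕ} (B : Instance m d) : Matrix (Fin d) (Fin m) ℝ :=
  fun j i => ∫ v, v j ∂(B.law i)

/-- `T` rounds of (randomized, non-anticipating) play, with rounds numbered `0, …, T - 1`.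
`hist t` is the information available before round `t` (it may contain extra randomness used by
the player); `prob t` is the distribution over arms chosen on the basis of it, `arm t` the arm
then drawn and `obs t` the observed vector. By `joint_law`, conditionally on `hist t` the arm is
`i` with probability `prob t · i`, and then the observation has law `B.law i`. -/
structure Play {m d : ℕ} (B : Instance m d) (T : ℕ) {Ω : Type*} [mΩ : MeasurableSpace Ω]
    (P : Measure Ω) where
  hist : Filtration ℕ mΩ
  prob : ℕ → Ω → Fin m → ℝ
  arm : ℕ → Ω → Fin m
  obs : ℕ → Ω → Vec d
  prob_measurable : ∀ t < T, ∀ i, Measurable[hist t] (fun ω => prob t ω i)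
  prob_mem : ∀ t < T, ∀ ω, prob t ω ∈ stdSimplex ℝ (Fin m)
  arm_measurable : ∀ t < T, Measurable[hist (t + 1)] (arm t)
  obs_measurable : ∀ t < T, Measurable[hist (t + 1)] (obs t)
  joint_law : ∀ t < T, ∀ A : Set Ω, MeasurableSet[hist t] A →
    ∀ (i : Fin m) (U : Set (Vec d)), MeasurableSet U →
      P (A ∩ {ω | arm t ω = i ∧ obs t ω ∈ U}) =
        (∫⁻ ω in A, ENNReal.ofReal (prob t ω i) ∂P) * B.law i U

section Play

variable {m d : ℕ} {B : Instance m d} {T : ℕ} {Ω : Type*} [MeasurableSpace Ω] {P : Measure Ω}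

/-- The average of the observed vectors over the `T` rounds. -/
def Play.avgObs (X : Play B T P) (ω : Ω) : Vec d :=
  (T : ℝ)⁻¹ • ∑ t ∈ Finset.range T, X.obs t ω

/-- The number of plays of arm `i` before round `t`. -/
def Play.count (X : Play B T P) (t : ℕ) (ω : Ω) (i : Fin m) : ℕ :=
  ((Finset.range t).filter (fun s => X.arm s ω = i)).card

/-- The empirical average of component `j` for arm `i` before round `t`
(with the number of plays plus one in the denominator). -/
def Play.emp (X : Play B T P) (t : ℕ) (ω : Ω) (j : Fin d) (i : Fin m) : ℝ :=
  (∑ s ∈ (Finset.range t).filter (fun s => X.arm s ω = i), X.obs s ω j) / (X.count t ω i + 1)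

end Play

/-- The confidence radius. -/
def rad (γ ν N : ℝ) : ℝ := √(γ * ν / N) + γ / N

section Estimates

variable {m d : ℕ} {B : Instance m d} {T : ℕ} {Ω : Type*} [MeasurableSpace Ω] {P : Measure Ω}

/-- Upper confidence bound. -/
def Play.ucb (X : Play B T P) (γ : ℝ) (t : ℕ) (ω : Ω) (j : Fin d) (i : Fin m) : ℝ :=
  min 1 (X.emp t ω j i + 2 * rad γ (X.emp t ω j i) (X.count t ω i + 1))

/-- Lower confidence bound. -/
def Play.lcb (X : Play B T P) (γ : ℝ) (t : ℕ) (ω : Ω) (j : Fin d) (i : Fin m) : ℝ :=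
  max 0 (X.emp t ω j i - 2 * rad γ (X.emp t ω j i) (X.count t ω i + 1))

/-- The box of matrices whose entries lie between the two confidence bounds. -/
def Play.confBox (X : Play B T P) (γ : ℝ) (t : ℕ) (ω : Ω) : Set (Matrix (Fin d) (Fin m) ℝ) :=
  {M | ∀ j i, M j i ∈ Set.Icc (X.lcb γ t ω j i) (X.ucb γ t ω j i)}

/-- The average of the estimated vectors `x_s = M_s p_s` over the first `t` rounds;
before the first round it is a prescribed starting point `x₀`. -/
def Play.avgEst (X : Play B T P) (est : ℕ → Ω → Matrix (Fin d) (Fin m) ℝ) (x₀ : Vec d)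
    (t : ℕ) (ω : Ω) : Vec d :=
  if t = 0 then x₀
  else (t : ℝ)⁻¹ • ∑ s ∈ Finset.range t, mixture (est s ω) (X.prob s ω)

/-- The play `X` with estimate matrices `est` follows the Frank–Wolfe based primal algorithm for
the objective `F`, with confidence parameter `γ` and starting point `x₀`: in every round the pair
(distribution, estimate matrix) is chosen from the history and maximizes
`(M p) · ∇F(average of the previous x_s)` over the simplex and the confidence box.
Ties may be broken in any way. -/
structure IsPrimalRun (X : Play B T P) (est : ℕ → Ω → Matrix (Fin d) (Fin m) ℝ) (γ : ℝ)
    (F : Vec d → ℝ) (x₀ : Vec d) : Prop where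
  est_measurable : ∀ t < T, ∀ j i, Measurable[X.hist t] (fun ω => est t ω j i)
  est_mem : ∀ t < T, ∀ᵐ ω ∂P, est t ω ∈ X.confBox γ t ω
  maximal : ∀ t < T, ∀ᵐ ω ∂P, ∀ p ∈ stdSimplex ℝ (Fin m), ∀ M ∈ X.confBox γ t ω,
    inner ℝ (mixture M p) (gradient F (X.avgEst est x₀ t ω)) ≤
      inner ℝ (mixture (est t ω) (X.prob t ω)) (gradient F (X.avgEst est x₀ t ω))

end Estimates

/-- The expected value of the optimal dynamic policy for maximizing `f` of the average
observation over `T` rounds (no constraints): the supremum over all randomized non-anticipating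
policies. -/
def optValue {m d : ℕ} (B : Instance m d) (T : ℕ) (f : Vec d → ℝ) : ℝ :=
  sSup {r | ∃ (Ω : Type) (_ : MeasurableSpace Ω) (P : Measure Ω) (_ : IsProbabilityMeasure P)
    (X : Play B T P), r = ∫ ω, f (X.avgObs ω) ∂P}

/-- Average regret in the objective. -/
def regretObj {m d : ℕ} {B : Instance m d} {T : ℕ} {Ω : Type*} [MeasurableSpace Ω]
    {P : Measure Ω} (X : Play B T P) (f : Vec d → ℝ) (ω : Ω) : ℝ :=
  optValue B T f - f (X.avgObs ω)

/-- Average regret in the constraints: the distance of the average observation from `S`. -/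
def regretCon {m d : ℕ} {B : Instance m d} {T : ℕ} {Ω : Type*} [MeasurableSpace Ω]
    {P : Measure Ω} (X : Play B T P) (S : Set (Vec d)) (ω : Ω) : ℝ :=
  Metric.infDist (X.avgObs ω) S

/-- The Fenchel conjugate `f*(θ) = max_{y ∈ [0,1]^d} (y · θ + f y)`. -/
def fenchel {d : ℕ} (f : Vec d → ℝ) (θ : Vec d) : ℝ :=
  sSup ((fun y => inner ℝ y θ + f y) '' cube d)

/-- Nesterov's smooth approximation
`z ↦ min_{‖θ‖ ≤ L} (f*(θ) + μ / (2 L) θ · θ - θ · z)`. -/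
def smoothApprox {d : ℕ} (f : Vec d → ℝ) (L μ : ℝ) (z : Vec d) : ℝ :=
  sInf ((fun θ => fenchel f θ + μ / (2 * L) * inner ℝ θ θ - inner ℝ θ z) ''
    Metric.closedBall (0 : Vec d) L)

/-- The smoothing parameter `√((d / T) log (2 T))`, with logarithm to base two. -/
def smoothingParam (d T : ℕ) : ℝ := √((d : ℝ) / T * Real.logb 2 (2 * T))

end Bandit

end

noncomputable section

namespace Bandit

/-! ### Geometry of the cube. -/

section Cube

variable {d : ℕ}

/-! Both parts reduce to one pathwise claim, `Play.IsTypical.regret_le`: on a typical outcome the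
algorithm competes with `f (V p)` for every fixed distribution `p`. For BwR this suffices because
the expected average observation of any policy has the form `V p`, so Jensen's inequality bounds the
optimum (`optValue_le`). For BwC, `f` is minus the distance to `S`, and the feasible `p` has value
zero.

The pathwise claim joins three estimates. Optimism: the true means `V` lie in every confidence box,
so `(p, V)` is always a candidate and the chosen pair has at least its linearized value. This is
what a Frank–Wolfe step needs, and `frankWolfe_bound` gives an optimization error of order `(L / μ)
d log T / T` for the smoothed objective. Smoothing: the approximation lies between `f` and `f + L μ`
on the cube (`le_smoothApprox`, `smoothApprox_le`) and obeys a quadratic bound with constant `L / μ`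
(`smoothApprox_gradient_bounds`); the chosen `μ` balances the two errors. Estimation: the averages
of `M_t p_t` and of `v_t` differ by the accumulated confidence widths plus martingale noise
(`Play.IsTypical.norm_avgEst_sub_avgObs_le`), and the widths at the played arms sum to order `√(γ m
T)`.

All the concentration comes from one exponential supermartingale, `Play.measure_sum_gt_le`, followed
by a union bound. -/

lemma cube_eq_preimage (d : ℕ) :
    cube d = (EuclideanSpace.equiv (Fin d) ℝ) ⁻¹' (Set.Icc 0 1) := by
  ext x
  simp only [cube, Set.mem_ofPred_eq, Set.mem_preimage, Set.mem_Icc, Pi.le_def]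
  exact forall_and

lemma convex_cube (d : ℕ) : Convex ℝ (cube d) := by
  rw [cube_eq_preimage]
  exact (convex_Icc _ _).affine_preimage
    ((EuclideanSpace.equiv (Fin d) ℝ).toLinearEquiv.toLinearMap.toAffineMap)

lemma isClosed_cube (d : ℕ) : IsClosed (cube d) := by
  rw [cube_eq_preimage]
  exact isClosed_Icc.preimage (EuclideanSpace.equiv (Fin d) ℝ).continuous

lemma zero_mem_cube (d : ℕ) : (0 : Vec d) ∈ cube d := fun j => by simp

lemma norm_le_of_coord_le {x : Vec d} {r : ℝ} (hr : 0 ≤ r) (h : ∀ j, |x j| ≤ r) :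
    ‖x‖ ≤ √d * r := by
  rw [EuclideanSpace.norm_eq]
  apply Real.sqrt_le_iff.2
  refine ⟨by positivity, ?_⟩
  rw [mul_pow, Real.sq_sqrt (by positivity)]
  calc ∑ j, ‖x j‖ ^ 2 ≤ ∑ _j : Fin d, r ^ 2 :=
        Finset.sum_le_sum fun j _ => pow_le_pow_left₀ (norm_nonneg _) (h j) 2
    _ = d * r ^ 2 := by simp

lemma norm_ones (d : ℕ) : ‖ones d‖ = √d := by
  rw [EuclideanSpace.norm_eq]
  simp [ones]

lemma norm_sub_le_of_mem_cube {x y : Vec d} (hx : x ∈ cube d) (hy : y ∈ cube d) :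
    ‖x - y‖ ≤ √d := by
  have := norm_le_of_coord_le (x := x - y) zero_le_one fun j => by
    have := hx j
    have := hy j
    simp only [Set.mem_Icc, PiLp.sub_apply] at *
    rw [abs_le]
    constructor <;> linarith
  simpa using this

lemma norm_le_of_mem_cube {x : Vec d} (hx : x ∈ cube d) : ‖x‖ ≤ √d := by
  simpa using norm_sub_le_of_mem_cube hx (zero_mem_cube d)

end Cube

/-! ### Nesterov smoothing of a concave Lipschitz function. -/

section Smoothing

variable {d : ℕ} {f : Vec d → ℝ} {L : ℝ}

/-- A concave Lipschitz function on the cube has a supergradient whose norm is at most the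
Lipschitz constant. -/
lemma exists_supergradient (hL : 0 < L) (hf : ConcaveOn ℝ (cube d) f)
    (hLip : ∀ x ∈ cube d, ∀ y ∈ cube d, f x - f y ≤ L * ‖x - y‖) {z : Vec d} (hz : z ∈ cube d) :
    ∃ θ : Vec d, ‖θ‖ ≤ L ∧ ∀ y ∈ cube d, inner ℝ y θ + f y ≤ inner ℝ z θ + f z := by
  have hA : Convex ℝ {q : Vec d × ℝ | q.1 ∈ cube d ∧ q.2 ≤ f q.1} := hf.convex_hypograph
  have hcv : ConvexOn ℝ Set.univ fun x : Vec d => f z + L * ‖x - z‖ := by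
    have h1 : ConvexOn ℝ Set.univ fun x : Vec d => ‖x - z‖ := by
      simpa [dist_eq_norm] using convexOn_univ_dist (E := Vec d) z
    exact (convexOn_const _ convex_univ).add (h1.smul hL.le)
  -- The hyperplane is to separate the hypograph of `f` from the open cone of slope `L` with apex
  -- `(z, f z)`; the cone forces its slope to be at most `L`.
  have hB : Convex ℝ {q : Vec d × ℝ | q.1 ∈ Set.univ ∧ f z + L * ‖q.1 - z‖ < q.2} :=
    hcv.convex_strict_epigraph
  have hBo : IsOpen {q : Vec d × ℝ | q.1 ∈ Set.univ ∧ f z + L * ‖q.1 - z‖ < q.2} := by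
    simp only [Set.mem_univ, true_and]
    exact isOpen_lt (by fun_prop) (by fun_prop)
  obtain ⟨φ, u, hφB, hφA⟩ := geometric_hahn_banach_open hB hBo hA (by
    rw [Set.disjoint_left]
    rintro ⟨x, r⟩ ⟨-, h1⟩ ⟨h2, h3⟩
    have := hLip x h2 z hz
    simp only at h1 h2 h3
    linarith)
  set s := φ (0, 1) with hs
  have hsplit : ∀ x r, φ (x, r) = φ (x, 0) + r * s := by
    intro x r
    have : (x, r) = (x, (0 : ℝ)) + r • ((0 : Vec d), (1 : ℝ)) := by ext <;> simp
    rw [this, map_add, map_smul, smul_eq_mul]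
  have hBA : ∀ x r y, f z + L * ‖x - z‖ < r → y ∈ cube d →
      φ (x, 0) + r * s < φ (y, 0) + f y * s := by
    intro x r y hr hy
    have h1 := hφB (x, r) ⟨trivial, hr⟩
    have h2 := hφA (y, f y) ⟨hy, le_rfl⟩
    rw [hsplit] at h1 h2
    linarith
  -- Testing two points above the same `z` shows that the hyperplane is not vertical.
  have hs0 : s < 0 := by
    have := hBA z (f z + 1) z (by simp) hz
    linarith
  have hcl : ∀ x y, y ∈ cube d →
      φ (x, 0) + (f z + L * ‖x - z‖) * s ≤ φ (y, 0) + f y * s := by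
    intro x y hy
    refine le_of_forall_pos_le_add fun ε hε => ?_
    have h := hBA x (f z + L * ‖x - z‖ + ε / (-s)) y
      (by have : 0 < ε / (-s) := div_pos hε (by linarith)
          linarith) hy
    have : ε / (-s) * s = -ε := by field_simp [hs0.ne]
    nlinarith
  let ψ : Vec d →L[ℝ] ℝ := s⁻¹ • φ.comp (ContinuousLinearMap.inl ℝ (Vec d) ℝ)
  have hψ : ∀ x, φ (x, 0) = ψ x * s := by
    intro x
    simp only [ψ, _root_.smul_apply, ContinuousLinearMap.comp_apply,
      ContinuousLinearMap.inl_apply, smul_eq_mul]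
    field_simp [hs0.ne]
  -- Taking `y = z` bounds the norm of `ψ`; taking `x = z` gives the supergradient inequality.
  have key : ∀ x y, y ∈ cube d → ψ y + f y ≤ ψ x + (f z + L * ‖x - z‖) := by
    intro x y hy
    have h := hcl x y hy
    rw [hψ, hψ, ← add_mul, ← add_mul] at h
    exact (mul_le_mul_right_of_neg hs0).1 h
  refine ⟨(InnerProductSpace.toDual ℝ (Vec d)).symm ψ, ?_, fun y hy => ?_⟩
  · rw [LinearIsometryEquiv.norm_map]
    refine ContinuousLinearMap.opNorm_le_bound _ hL.le fun x => ?_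
    rw [Real.norm_eq_abs, abs_le]
    have h1 := key (z + x) z hz
    have h2 := key (z - x) z hz
    simp only [map_add, map_sub, add_sub_cancel_left, sub_sub_cancel_left, norm_neg] at h1 h2
    constructor <;> linarith
  · have h := key z y hy
    rw [real_inner_comm, InnerProductSpace.toDual_symm_apply, real_inner_comm,
      InnerProductSpace.toDual_symm_apply]
    simpa using h

lemma bddAbove_fenchel (hL : 0 < L)
    (hLip : ∀ x ∈ cube d, ∀ y ∈ cube d, f x - f y ≤ L * ‖x - y‖) (θ : Vec d) :
    BddAbove ((fun y => inner ℝ y θ + f y) '' cube d) := by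
  refine ⟨√d * ‖θ‖ + (f 0 + L * √d), ?_⟩
  rintro _ ⟨y, hy, rfl⟩
  have h1 := real_inner_le_norm y θ
  have h2 := hLip y hy 0 (zero_mem_cube d)
  rw [sub_zero] at h2
  have h3 := norm_le_of_mem_cube hy
  have h4 := mul_le_mul_of_nonneg_right h3 (norm_nonneg θ)
  have h5 := mul_le_mul_of_nonneg_left h3 hL.le
  simp only
  linarith

lemma le_fenchel (hL : 0 < L)
    (hLip : ∀ x ∈ cube d, ∀ y ∈ cube d, f x - f y ≤ L * ‖x - y‖) (θ : Vec d)
    {y : Vec d} (hy : y ∈ cube d) : inner ℝ y θ + f y ≤ fenchel f θ :=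
  le_csSup (bddAbove_fenchel hL hLip θ) ⟨y, hy, rfl⟩

lemma fenchel_le {θ : Vec d} {r : ℝ} (h : ∀ y ∈ cube d, inner ℝ y θ + f y ≤ r) :
    fenchel f θ ≤ r :=
  csSup_le (Set.Nonempty.image _ ⟨0, zero_mem_cube d⟩) (by rintro _ ⟨y, hy, rfl⟩; exact h y hy)

lemma continuous_fenchel (hL : 0 < L)
    (hLip : ∀ x ∈ cube d, ∀ y ∈ cube d, f x - f y ≤ L * ‖x - y‖) : Continuous (fenchel f) := by
  refine (LipschitzWith.of_le_add_mul (Real.toNNReal √d) fun θ θ' => ?_).continuous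
  refine fenchel_le fun y hy => ?_
  have h1 := le_fenchel hL hLip θ' hy
  have h2 := real_inner_le_norm y (θ - θ')
  rw [inner_sub_right] at h2
  have h3 := mul_le_mul_of_nonneg_right (norm_le_of_mem_cube hy) (norm_nonneg (θ - θ'))
  rw [dist_eq_norm]
  rw [Real.coe_toNNReal _ (Real.sqrt_nonneg _)]
  linarith

lemma fenchel_midpoint_le (hL : 0 < L)
    (hLip : ∀ x ∈ cube d, ∀ y ∈ cube d, f x - f y ≤ L * ‖x - y‖) (θ θ' : Vec d) :
    fenchel f ((2 : ℝ)⁻¹ • (θ + θ')) ≤ (fenchel f θ + fenchel f θ') / 2 := by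
  refine fenchel_le fun y hy => ?_
  have h1 := le_fenchel hL hLip θ hy
  have h2 := le_fenchel hL hLip θ' hy
  rw [inner_smul_right, inner_add_right]
  linarith

/-- The smoothed function lies between two quadratically close affine bounds at every point. -/
lemma exists_smoothApprox_bounds {μ : ℝ} (hL : 0 < L) (hμ : 0 < μ)
    (hLip : ∀ x ∈ cube d, ∀ y ∈ cube d, f x - f y ≤ L * ‖x - y‖) (x : Vec d) :
    ∃ θ : Vec d, ∀ y,
      smoothApprox f L μ y ≤ smoothApprox f L μ x - inner ℝ θ (y - x) ∧
      smoothApprox f L μ x - inner ℝ θ (y - x) - L / μ * ‖y - x‖ ^ 2 ≤ smoothApprox f L μ y := by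
  set h : Vec d → Vec d → ℝ :=
    fun z θ => fenchel f θ + μ / (2 * L) * inner ℝ θ θ - inner ℝ θ z with hh
  have hmin : ∀ z, ∃ θ ∈ Metric.closedBall (0 : Vec d) L,
      (∀ θ' ∈ Metric.closedBall (0 : Vec d) L, h z θ ≤ h z θ') ∧ smoothApprox f L μ z = h z θ := by
    intro z
    have hc : Continuous (h z) := by
      have := continuous_fenchel hL hLip
      fun_prop
    obtain ⟨θ, hθ, hle⟩ := (isCompact_closedBall (0 : Vec d) L).exists_isMinOn
      ⟨0, by simp [hL.le]⟩ hc.continuousOn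
    refine ⟨θ, hθ, fun θ' h' => hle h', ?_⟩
    have : IsLeast (h z '' Metric.closedBall (0 : Vec d) L) (h z θ) :=
      ⟨⟨θ, hθ, rfl⟩, by rintro _ ⟨θ', h', rfl⟩; exact hle h'⟩
    exact this.csInf_eq
  obtain ⟨θ, hθ, hle, heq⟩ := hmin x
  refine ⟨θ, fun y => ?_⟩
  obtain ⟨η, hη, hleη, heqη⟩ := hmin y
  rw [heq, heqη]
  refine ⟨?_, ?_⟩
  -- The minimizer for `x` is a competitor in the problem for `y`.
  · have := hleη θ hθ
    simp only [hh, inner_sub_right] at this ⊢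
    linarith
  · have hmid := hle ((2 : ℝ)⁻¹ • (θ + η)) (by
      have := (convex_closedBall (0 : Vec d) L) hθ hη (a := 2⁻¹) (b := 2⁻¹)
        (by norm_num) (by norm_num) (by norm_num)
      rwa [← smul_add] at this)
    have hfm := fenchel_midpoint_le hL hLip θ η
    -- Quadratic growth at the minimizer, from strong convexity tested at the midpoint only.
    have hsc : h x θ + μ / (4 * L) * ‖η - θ‖ ^ 2 ≤ h x η := by
      have e : ‖η - θ‖ ^ 2 = inner ℝ η η - 2 * inner ℝ θ η + inner ℝ θ θ := by
        rw [← real_inner_self_eq_norm_sq, inner_sub_left, inner_sub_right, inner_sub_right,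
          real_inner_comm θ η]
        ring
      have e2 : μ / (2 * L) = 2 * (μ / (4 * L)) := by field_simp; norm_num
      simp only [hh, inner_smul_left, inner_smul_right, inner_add_left, inner_add_right,
        real_inner_comm η θ] at hmid ⊢
      rw [e, real_inner_comm η θ]
      rw [e2] at hmid ⊢
      simp only [map_inv₀, conj_trivial] at hmid
      nlinarith
    have hyx : h y η = h x η - inner ℝ θ (y - x) - inner ℝ (η - θ) (y - x) := by
      simp only [hh, inner_sub_left, inner_sub_right]
      ring
    have hcs := real_inner_le_norm (η - θ) (y - x)
    -- The growth term absorbs the cross term, leaving the smoothness constant `L / μ`.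
    have ham : ‖η - θ‖ * ‖y - x‖ ≤ μ / (4 * L) * ‖η - θ‖ ^ 2 + L / μ * ‖y - x‖ ^ 2 := by
      have e : μ / (4 * L) * ‖η - θ‖ ^ 2 + L / μ * ‖y - x‖ ^ 2 - ‖η - θ‖ * ‖y - x‖
          = L / μ * (μ / (2 * L) * ‖η - θ‖ - ‖y - x‖) ^ 2 := by
        field_simp
        ring
      have : 0 ≤ L / μ * (μ / (2 * L) * ‖η - θ‖ - ‖y - x‖) ^ 2 := by positivity
      linarith
    linarith

lemma hasGradientAt_of_quadratic_bound {F : Vec d → ℝ} {x g : Vec d} {K : ℝ}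
    (h : ∀ y, |F y - F x - inner ℝ g (y - x)| ≤ K * ‖y - x‖ ^ 2) : HasGradientAt F g x := by
  rw [hasGradientAt_iff_isLittleO]
  refine Asymptotics.IsBigO.trans_isLittleO (g := fun y => ‖y - x‖ ^ 2) ?_ ?_
  · refine Asymptotics.IsBigO.of_bound K (Filter.Eventually.of_forall fun y => ?_)
    simpa using h y
  · have h1 : (fun y : Vec d => ‖y - x‖) =o[nhds x] fun _ => (1 : ℝ) := by
      rw [Asymptotics.isLittleO_one_iff]
      have : Filter.Tendsto (fun y : Vec d => ‖y - x‖) (nhds x) (nhds ‖x - x‖) := by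
        apply Continuous.tendsto (f := fun y : Vec d => ‖y - x‖)
        fun_prop
      simpa using this
    have h2 := h1.mul_isBigO (Asymptotics.isBigO_refl (fun y : Vec d => ‖y - x‖) (nhds x))
    simp only [one_mul, ← pow_two] at h2
    exact h2.trans_isBigO (Asymptotics.isBigO_refl _ _).norm_left

/-- The smoothed function is concave and its gradient is Lipschitz, in first-order form. -/
lemma smoothApprox_gradient_bounds {μ : ℝ} (hL : 0 < L) (hμ : 0 < μ)
    (hLip : ∀ x ∈ cube d, ∀ y ∈ cube d, f x - f y ≤ L * ‖x - y‖) (x y : Vec d) :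
    smoothApprox f L μ y ≤
        smoothApprox f L μ x + inner ℝ (y - x) (gradient (smoothApprox f L μ) x) ∧
    smoothApprox f L μ x + inner ℝ (y - x) (gradient (smoothApprox f L μ) x)
        - L / μ * ‖y - x‖ ^ 2 ≤ smoothApprox f L μ y := by
  obtain ⟨θ, hθ⟩ := exists_smoothApprox_bounds hL hμ hLip x
  -- The two-sided quadratic bound itself identifies the gradient as minus the minimizer.
  have hg : HasGradientAt (smoothApprox f L μ) (-θ) x := by
    refine hasGradientAt_of_quadratic_bound (K := L / μ) fun y => ?_
    obtain ⟨h1, h2⟩ := hθ y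
    rw [inner_neg_left, abs_le]
    have : 0 ≤ L / μ * ‖y - x‖ ^ 2 := by positivity
    constructor <;> linarith
  rw [hg.gradient, inner_neg_right, real_inner_comm]
  obtain ⟨h1, h2⟩ := hθ y
  constructor <;> linarith

lemma mem_lowerBounds_smoothApprox {μ : ℝ} (hL : 0 < L) (hμ : 0 < μ)
    (hLip : ∀ x ∈ cube d, ∀ y ∈ cube d, f x - f y ≤ L * ‖x - y‖) {z : Vec d} (hz : z ∈ cube d) :
    f z ∈ lowerBounds ((fun θ => fenchel f θ + μ / (2 * L) * inner ℝ θ θ - inner ℝ θ z) ''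
      Metric.closedBall (0 : Vec d) L) := by
  rintro _ ⟨θ, -, rfl⟩
  have h1 := le_fenchel hL hLip θ hz
  have h2 : 0 ≤ μ / (2 * L) * inner ℝ θ θ := mul_nonneg (by positivity) real_inner_self_nonneg
  simp only
  rw [real_inner_comm] at h1
  linarith

lemma le_smoothApprox {μ : ℝ} (hL : 0 < L) (hμ : 0 < μ)
    (hLip : ∀ x ∈ cube d, ∀ y ∈ cube d, f x - f y ≤ L * ‖x - y‖) {z : Vec d} (hz : z ∈ cube d) :
    f z ≤ smoothApprox f L μ z :=
  le_csInf (Set.Nonempty.image _ ⟨0, by simp [hL.le]⟩) (mem_lowerBounds_smoothApprox hL hμ hLip hz)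

/-- A supergradient at `z` is admissible in the minimum because its norm is at most `L`. It attains
the unsmoothed value, and its quadratic penalty is at most `L μ / 2`. -/
lemma smoothApprox_le {μ : ℝ} (hL : 0 < L) (hμ : 0 < μ) (hf : ConcaveOn ℝ (cube d) f)
    (hLip : ∀ x ∈ cube d, ∀ y ∈ cube d, f x - f y ≤ L * ‖x - y‖) {z : Vec d} (hz : z ∈ cube d) :
    smoothApprox f L μ z ≤ f z + L * μ := by
  obtain ⟨θ, hθ, h⟩ := exists_supergradient hL hf hLip hz
  refine (csInf_le ⟨_, mem_lowerBounds_smoothApprox hL hμ hLip hz⟩ ⟨θ, by simpa using hθ, rfl⟩).trans ?_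
  have h1 := fenchel_le h
  have h2 : μ / (2 * L) * inner ℝ θ θ ≤ L * μ := by
    rw [real_inner_self_eq_norm_sq]
    calc μ / (2 * L) * ‖θ‖ ^ 2 ≤ μ / (2 * L) * L ^ 2 := by gcongr
      _ = L * μ / 2 := by field_simp
      _ ≤ L * μ := by nlinarith [mul_pos hL hμ]
  simp only
  rw [real_inner_comm] at h1
  linarith

end Smoothing

/-! ### Frank–Wolfe iteration. -/

/-- The regret bound of the Frank–Wolfe iteration with step sizes `1 / (t + 1)`. -/
lemma frankWolfe_bound {d : ℕ} {F : Vec d → ℝ} {K : ℝ} (hK : 0 ≤ K)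
    (hF : ∀ x y, F y ≤ F x + inner ℝ (y - x) (gradient F x) ∧
      F x + inner ℝ (y - x) (gradient F x) - K * ‖y - x‖ ^ 2 ≤ F y)
    {a x : ℕ → Vec d} {z : Vec d} {T : ℕ}
    (ha : ∀ t < T, a t ∈ cube d) (hx : ∀ t < T, x t ∈ cube d)
    (hrec : ∀ t < T, ((t : ℝ) + 1) • (a (t + 1) - a t) = x t - a t)
    (hmax : ∀ t < T, inner ℝ z (gradient F (a t)) ≤ inner ℝ (x t) (gradient F (a t))) :
    T * (F z - F (a T)) ≤ K * d * ∑ t ∈ Finset.range T, ((t : ℝ) + 1)⁻¹ := by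
  -- The gap weighted by `n` grows by at most `K d / n` at step `n`; the weight zero at the start
  -- removes any dependence on the initial gap.
  suffices h : ∀ n ≤ T, n * (F z - F (a n)) ≤ K * d * ∑ t ∈ Finset.range n, ((t : ℝ) + 1)⁻¹ from
    h T le_rfl
  intro n
  induction n with
  | zero => simp
  | succ t ih =>
    intro ht
    have ht' : t < T := ht
    have ih := ih ht'.le
    rw [Finset.sum_range_succ, mul_add]
    set n : ℝ := (t : ℝ) + 1 with hn
    have hn0 : 0 < n := by positivity
    have hstep : a (t + 1) - a t = n⁻¹ • (x t - a t) := by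
      rw [← hrec t ht', smul_smul, inv_mul_cancel₀ hn0.ne', one_smul]
    have h1 := (hF (a t) (a (t + 1))).2
    rw [hstep, inner_smul_left, norm_smul, mul_pow] at h1
    have h2 := (hF (a t) z).1
    have h3 := hmax t ht'
    have h4 : ‖x t - a t‖ ^ 2 ≤ d := by
      have := pow_le_pow_left₀ (norm_nonneg _) (norm_sub_le_of_mem_cube (hx t ht') (ha t ht')) 2
      rwa [Real.sq_sqrt (by positivity)] at this
    rw [inner_sub_left] at h1 h2
    simp only [map_inv₀, conj_trivial, norm_inv, Real.norm_of_nonneg hn0.le] at h1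
    have h5 : n * F (a t) + (inner ℝ (x t) (gradient F (a t)) - inner ℝ (a t) (gradient F (a t)))
        - K * n⁻¹ * ‖x t - a t‖ ^ 2 ≤ n * F (a (t + 1)) := by
      have := mul_le_mul_of_nonneg_left h1 hn0.le
      refine le_trans (le_of_eq ?_) this
      field_simp
    have h6 : K * n⁻¹ * ‖x t - a t‖ ^ 2 ≤ K * d * n⁻¹ := by
      calc K * n⁻¹ * ‖x t - a t‖ ^ 2 ≤ K * n⁻¹ * d := by gcongr
        _ = K * d * n⁻¹ := by ring
    have h7 : ((t + 1 : ℕ) : ℝ) = n := by push_cast; rfl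
    rw [h7]
    have h8 : (t : ℝ) = n - 1 := by rw [hn]; ring
    rw [h8] at ih
    linarith

lemma sum_inv_le_one_add_log (T : ℕ) :
    ∑ t ∈ Finset.range T, ((t : ℝ) + 1)⁻¹ ≤ 1 + Real.log T := by
  have := harmonic_le_one_add_log T
  simpa [harmonic] using this

/-! ### Conditioning on the history, and exponential supermartingales. -/

section Tower

variable {m d : ℕ} {B : Instance m d} {T : ℕ} {Ω : Type*} [mΩ : MeasurableSpace Ω]
  {P : Measure Ω}

lemma measurable_apply_arm {Ω' E : Type*} [MeasurableSpace Ω'] [MeasurableSpace E]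
    {arm : Ω' → Fin m} (harm : Measurable arm) {g : Fin m → Ω' → E} (hg : ∀ i, Measurable (g i)) :
    Measurable fun ω => g (arm ω) ω :=
  (measurable_from_prod_countable_right (f := fun q : Fin m × Ω' => g q.1 q.2) hg).comp
    (harm.prodMk measurable_id)

lemma Play.arm_measurable_of_lt (X : Play B T P) {s t : ℕ} (hst : s < t) (ht : t ≤ T) :
    Measurable[X.hist t] (X.arm s) :=
  (X.arm_measurable s (hst.trans_le ht)).mono (X.hist.mono hst) le_rfl

lemma Play.measurable_arm (X : Play B T P) {t : ℕ} (ht : t < T) : Measurable (X.arm t) :=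
  (X.arm_measurable t ht).mono (X.hist.le _) le_rfl

lemma Play.measurable_obs (X : Play B T P) {t : ℕ} (ht : t < T) : Measurable (X.obs t) :=
  (X.obs_measurable t ht).mono (X.hist.le _) le_rfl

lemma Play.measurable_prob (X : Play B T P) {t : ℕ} (ht : t < T) (i : Fin m) :
    Measurable fun ω => X.prob t ω i :=
  (X.prob_measurable t ht i).mono (X.hist.le _) le_rfl

lemma Play.measurableSet_arm (X : Play B T P) {t : ℕ} (ht : t < T) (i : Fin m) :
    MeasurableSet {ω | X.arm t ω = i} :=
  X.measurable_arm ht (measurableSet_singleton i)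

lemma Play.setLIntegral_obs (X : Play B T P) {t : ℕ} (ht : t < T) (i : Fin m)
    {A : Set Ω} (hA : MeasurableSet[X.hist t] A) {ψ : Vec d → ENNReal} (hψ : Measurable ψ) :
    ∫⁻ ω in A ∩ {ω | X.arm t ω = i}, ψ (X.obs t ω) ∂P =
      (∫⁻ ω in A, ENNReal.ofReal (X.prob t ω i) ∂P) * ∫⁻ v, ψ v ∂(B.law i) := by
  have hmap : (P.restrict (A ∩ {ω | X.arm t ω = i})).map (X.obs t) =
      (∫⁻ ω in A, ENNReal.ofReal (X.prob t ω i) ∂P) • B.law i := by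
    ext U hU
    rw [Measure.map_apply (X.measurable_obs ht) hU,
      Measure.restrict_apply (X.measurable_obs ht hU), Measure.smul_apply, smul_eq_mul,
      ← X.joint_law t ht A hA i U hU]
    congr 1
    ext ω
    simp only [Set.mem_inter_iff, Set.mem_preimage, Set.mem_ofPred_eq]
    tauto
  rw [← lintegral_map hψ (X.measurable_obs ht), hmap, lintegral_smul_measure, smul_eq_mul]

lemma Play.setLIntegral_mul_obs (X : Play B T P) {t : ℕ} (ht : t < T) (i : Fin m)
    {h : Ω → ENNReal} (hh : Measurable[X.hist t] h) {ψ : Vec d → ENNReal} (hψ : Measurable ψ) :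
    ∫⁻ ω in {ω | X.arm t ω = i}, h ω * ψ (X.obs t ω) ∂P =
      (∫⁻ ω, h ω * ENNReal.ofReal (X.prob t ω i) ∂P) * ∫⁻ v, ψ v ∂(B.law i) := by
  have hle := X.hist.le t
  have hψo : Measurable fun ω => ψ (X.obs t ω) := hψ.comp (X.measurable_obs ht)
  have hp : Measurable fun ω => ENNReal.ofReal (X.prob t ω i) :=
    (X.measurable_prob ht i).ennreal_ofReal
  -- Two measures that agree on the history σ-algebra integrate the history-measurable `h` alike;
  -- this extends the formula from events to functions.
  have hm : ((P.restrict {ω | X.arm t ω = i}).withDensity fun ω => ψ (X.obs t ω)).trim hle =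
      ((∫⁻ v, ψ v ∂(B.law i)) •
        P.withDensity fun ω => ENNReal.ofReal (X.prob t ω i)).trim hle := by
    refine @Measure.ext _ (X.hist t) _ _ fun A hA => ?_
    rw [trim_measurableSet_eq hle hA, trim_measurableSet_eq hle hA,
      withDensity_apply _ (hle A hA), Measure.smul_apply, withDensity_apply _ (hle A hA),
      Measure.restrict_restrict (hle A hA), X.setLIntegral_obs ht i hA hψ, smul_eq_mul, mul_comm]
  have h1 : ∫⁻ ω, h ω ∂((P.restrict {ω | X.arm t ω = i}).withDensity fun ω => ψ (X.obs t ω)) =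
      ∫⁻ ω, h ω ∂((∫⁻ v, ψ v ∂(B.law i)) •
        P.withDensity fun ω => ENNReal.ofReal (X.prob t ω i)) := by
    rw [← lintegral_trim hle hh, hm, lintegral_trim hle hh]
  have hh' : Measurable h := hh.mono hle le_rfl
  rw [lintegral_smul_measure, lintegral_withDensity_eq_lintegral_mul _ hψo hh',
    lintegral_withDensity_eq_lintegral_mul _ hp hh', smul_eq_mul] at h1
  simp only [Pi.mul_apply] at h1
  rw [mul_comm (∫⁻ ω, _ ∂P)]
  simp_rw [mul_comm (h _)]
  exact h1

/-- The conditional expectation, given the history, of a function of the arm and the observation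
of round `t`, in integrated form. -/
lemma Play.lintegral_mul_arm_obs (X : Play B T P) {t : ℕ} (ht : t < T)
    {h : Fin m → Ω → ENNReal} (hh : ∀ i, Measurable[X.hist t] (h i))
    {ψ : Fin m → Vec d → ENNReal} (hψ : ∀ i, Measurable (ψ i)) :
    ∫⁻ ω, h (X.arm t ω) ω * ψ (X.arm t ω) (X.obs t ω) ∂P =
      ∑ i, (∫⁻ ω, h i ω * ENNReal.ofReal (X.prob t ω i) ∂P) * ∫⁻ v, ψ i v ∂(B.law i) := by
  have h1 : ∀ ω, h (X.arm t ω) ω * ψ (X.arm t ω) (X.obs t ω) =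
      ∑ i, {ω | X.arm t ω = i}.indicator (fun ω => h i ω * ψ i (X.obs t ω)) ω := by
    intro ω
    rw [Finset.sum_eq_single (X.arm t ω)]
    · simp
    · intro i _ hi
      simp [hi.symm]
    · simp
  simp_rw [h1]
  rw [lintegral_finsetSum]
  · refine Finset.sum_congr rfl fun i _ => ?_
    rw [lintegral_indicator (X.measurableSet_arm ht i), X.setLIntegral_mul_obs ht i (hh i) (hψ i)]
  · intro i _
    refine Measurable.indicator ?_ (X.measurableSet_arm ht i)
    exact ((hh i).mono (X.hist.le t) le_rfl).mul ((hψ i).comp (X.measurable_obs ht))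

lemma Play.ae_obs_mem_cube (X : Play B T P) {t : ℕ} (ht : t < T) :
    ∀ᵐ ω ∂P, X.obs t ω ∈ cube d := by
  have hc : MeasurableSet (cube d)ᶜ := (isClosed_cube d).measurableSet.compl
  have h : ∀ i, P {ω | X.arm t ω = i ∧ X.obs t ω ∈ (cube d)ᶜ} = 0 := by
    intro i
    have := X.joint_law t ht Set.univ MeasurableSet.univ i _ hc
    rw [Set.univ_inter] at this
    rw [this, (mem_ae_iff.1 (B.mem_cube i) : B.law i (cube d)ᶜ = 0), mul_zero]
  rw [ae_iff]
  refine measure_mono_null (t := ⋃ i, {ω | X.arm t ω = i ∧ X.obs t ω ∈ (cube d)ᶜ}) ?_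
    (measure_iUnion_null h)
  intro ω hω
  simpa using hω

lemma Play.ae_forall_obs_mem_cube (X : Play B T P) : ∀ᵐ ω ∂P, ∀ s < T, X.obs s ω ∈ cube d :=
  ae_all_iff.2 fun _ => ae_all_iff.2 fun hs => X.ae_obs_mem_cube hs

variable [IsProbabilityMeasure P]

/-- The partial products form a nonnegative supermartingale: `h1` says that each new factor has
conditional mean at most one. Measurability is carried through the induction because the product so
far serves as a history-measurable weight. -/
lemma Play.lintegral_prod_le_one (X : Play B T P)
    {a : ℕ → Fin m → Ω → ENNReal} (ha : ∀ t < T, ∀ i, Measurable[X.hist t] (a t i))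
    {ψ : ℕ → Fin m → Vec d → ENNReal} (hψ : ∀ t < T, ∀ i, Measurable (ψ t i))
    (h1 : ∀ t < T, ∀ ω,
      ∑ i, a t i ω * ENNReal.ofReal (X.prob t ω i) * ∫⁻ v, ψ t i v ∂(B.law i) ≤ 1)
    {t : ℕ} (ht : t ≤ T) :
    (Measurable[X.hist t] fun ω =>
      ∏ s ∈ Finset.range t, (a s (X.arm s ω) ω * ψ s (X.arm s ω) (X.obs s ω))) ∧
    ∫⁻ ω, ∏ s ∈ Finset.range t, (a s (X.arm s ω) ω * ψ s (X.arm s ω) (X.obs s ω)) ∂P ≤ 1 := by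
  induction t with
  | zero => simp
  | succ t ih =>
    have ht' : t < T := ht
    obtain ⟨ihm, ihl⟩ := ih ht'.le
    set M := fun ω => ∏ s ∈ Finset.range t, (a s (X.arm s ω) ω * ψ s (X.arm s ω) (X.obs s ω))
      with hM
    have hsucc : ∀ ω, ∏ s ∈ Finset.range (t + 1),
        (a s (X.arm s ω) ω * ψ s (X.arm s ω) (X.obs s ω)) =
        (M ω * a t (X.arm t ω) ω) * ψ t (X.arm t ω) (X.obs t ω) := by
      intro ω
      rw [Finset.prod_range_succ, hM, mul_assoc]
    simp_rw [hsucc]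
    constructor
    · have hle := X.hist.mono (Nat.le_succ t)
      refine Measurable.mul (Measurable.mul (ihm.mono hle le_rfl) ?_) ?_
      · exact @measurable_apply_arm _ _ _ (X.hist (t + 1)) _ _ (X.arm_measurable t ht') _
          fun i => (ha t ht' i).mono hle le_rfl
      · exact @measurable_apply_arm _ _ _ (X.hist (t + 1)) _ _ (X.arm_measurable t ht')
          (fun i ω => ψ t i (X.obs t ω)) fun i => (hψ t ht' i).comp (X.obs_measurable t ht')
    · rw [X.lintegral_mul_arm_obs ht' (h := fun i ω => M ω * a t i ω)
        (fun i => Measurable.mul ihm (ha t ht' i)) (hψ t ht')]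
      have hmeas : ∀ i, Measurable fun ω => M ω * a t i ω * ENNReal.ofReal (X.prob t ω i) :=
        fun i => ((ihm.mul (ha t ht' i)).mono (X.hist.le t) le_rfl).mul
          (X.measurable_prob ht' i).ennreal_ofReal
      rw [Finset.sum_congr rfl fun i _ =>
        (lintegral_mul_const (∫⁻ v, ψ t i v ∂(B.law i)) (hmeas i)).symm]
      rw [← lintegral_finsetSum _ fun i _ => (hmeas i).mul_const _]
      refine le_trans (lintegral_mono fun ω => ?_) ihl
      calc ∑ i, M ω * a t i ω * ENNReal.ofReal (X.prob t ω i) * ∫⁻ v, ψ t i v ∂(B.law i)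
          = M ω * ∑ i, a t i ω * ENNReal.ofReal (X.prob t ω i) * ∫⁻ v, ψ t i v ∂(B.law i) := by
            rw [Finset.mul_sum]
            simp_rw [mul_assoc]
        _ ≤ M ω * 1 := by gcongr; exact h1 t ht' ω
        _ = M ω := mul_one _

/-- Chernoff's bound for a sum whose conditional exponential moments are at most one. -/
lemma Play.measure_sum_gt_le (X : Play B T P)
    {α : ℕ → Fin m → Ω → ℝ} (hα : ∀ t < T, ∀ i, Measurable[X.hist t] (α t i))
    {β : Fin m → Vec d → ℝ} (hβ : ∀ i, Measurable (β i))
    {b : Fin m → ℝ}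
    (hb : ∀ i, ∫⁻ v, ENNReal.ofReal (Real.exp (β i v)) ∂(B.law i) ≤ ENNReal.ofReal (b i))
    (hb0 : ∀ i, 0 ≤ b i)
    (h1 : ∀ t < T, ∀ ω, ∑ i, X.prob t ω i * (Real.exp (α t i ω) * b i) ≤ 1)
    {t : ℕ} (ht : t ≤ T) (r : ℝ) :
    P {ω | r < ∑ s ∈ Finset.range t, (α s (X.arm s ω) ω + β (X.arm s ω) (X.obs s ω))} ≤
      ENNReal.ofReal (Real.exp (-r)) := by
  obtain ⟨hm, hl⟩ := X.lintegral_prod_le_one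
    (a := fun s i ω => ENNReal.ofReal (Real.exp (α s i ω)))
    (fun s hs i => (Real.measurable_exp.comp (hα s hs i)).ennreal_ofReal)
    (ψ := fun _ i v => ENNReal.ofReal (Real.exp (β i v)))
    (fun s _ i => (Real.measurable_exp.comp (hβ i)).ennreal_ofReal)
    (fun s hs ω => by
      have hp := X.prob_mem s hs ω
      calc ∑ i, ENNReal.ofReal (Real.exp (α s i ω)) * ENNReal.ofReal (X.prob s ω i) *
            ∫⁻ v, ENNReal.ofReal (Real.exp (β i v)) ∂(B.law i)
          ≤ ∑ i, ENNReal.ofReal (X.prob s ω i * (Real.exp (α s i ω) * b i)) := by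
            refine Finset.sum_le_sum fun i _ => ?_
            rw [ENNReal.ofReal_mul (hp.1 i), ENNReal.ofReal_mul (Real.exp_pos _).le,
              mul_comm (ENNReal.ofReal (Real.exp _)), mul_assoc]
            gcongr
            exact hb i
        _ = ENNReal.ofReal (∑ i, X.prob s ω i * (Real.exp (α s i ω) * b i)) := by
            rw [ENNReal.ofReal_sum_of_nonneg]
            intro i _
            exact mul_nonneg (hp.1 i) (mul_nonneg (Real.exp_pos _).le (hb0 i))
        _ ≤ 1 := by
            rw [← ENNReal.ofReal_one]
            exact ENNReal.ofReal_le_ofReal (h1 s hs ω)) ht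
  have hprod : ∀ ω, ∏ s ∈ Finset.range t, (ENNReal.ofReal (Real.exp (α s (X.arm s ω) ω)) *
      ENNReal.ofReal (Real.exp (β (X.arm s ω) (X.obs s ω)))) = ENNReal.ofReal (Real.exp
        (∑ s ∈ Finset.range t, (α s (X.arm s ω) ω + β (X.arm s ω) (X.obs s ω)))) := by
    intro ω
    rw [Real.exp_sum, ENNReal.ofReal_prod_of_nonneg fun _ _ => (Real.exp_pos _).le]
    refine Finset.prod_congr rfl fun s _ => ?_
    rw [Real.exp_add, ENNReal.ofReal_mul (Real.exp_pos _).le]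
  simp_rw [hprod] at hm hl
  -- Markov's inequality for the exponential of the sum.
  have hmarkov := mul_meas_ge_le_lintegral (μ := P) (hm.mono (X.hist.le t) le_rfl)
    (ENNReal.ofReal (Real.exp r))
  have hsub : P {ω | r < ∑ s ∈ Finset.range t,
      (α s (X.arm s ω) ω + β (X.arm s ω) (X.obs s ω))} ≤
      P {ω | ENNReal.ofReal (Real.exp r) ≤ ENNReal.ofReal (Real.exp
        (∑ s ∈ Finset.range t, (α s (X.arm s ω) ω + β (X.arm s ω) (X.obs s ω))))} :=
    measure_mono fun ω (hω : r < _) => ENNReal.ofReal_le_ofReal (Real.exp_le_exp.2 hω.le)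
  refine hsub.trans ?_
  have h2 := hmarkov.trans hl
  have h3 : ENNReal.ofReal (Real.exp (-r)) * ENNReal.ofReal (Real.exp r) = 1 := by
    rw [← ENNReal.ofReal_mul (Real.exp_pos _).le, ← Real.exp_add]
    simp
  calc P _ = ENNReal.ofReal (Real.exp (-r)) * (ENNReal.ofReal (Real.exp r) * P _) := by
        rw [← mul_assoc, h3, one_mul]
    _ ≤ ENNReal.ofReal (Real.exp (-r)) * 1 := by gcongr
    _ = _ := mul_one _

end Tower

/-! ### Exponential moments of observations in the cube. -/

section ExponentialMoments

variable {m d : ℕ} (B : Instance m d)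

lemma Instance.ae_coord_mem (i : Fin m) (j : Fin d) :
    ∀ᵐ v ∂(B.law i), v j ∈ Set.Icc (0 : ℝ) 1 := by
  filter_upwards [B.mem_cube i] with v hv using hv j

lemma measurable_coord (j : Fin d) : Measurable fun v : Vec d => v j := by fun_prop

lemma Instance.integrable_coord (i : Fin m) (j : Fin d) :
    Integrable (fun v : Vec d => v j) (B.law i) := by
  have := B.isProb i
  refine Integrable.of_bound (measurable_coord j).aestronglyMeasurable 1 ?_
  filter_upwards [B.ae_coord_mem i j] with v hv
  rw [Real.norm_eq_abs, abs_of_nonneg hv.1]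
  exact hv.2

lemma Instance.mean_mem (j : Fin d) (i : Fin m) : B.mean j i ∈ Set.Icc (0 : ℝ) 1 := by
  have := B.isProb i
  constructor
  · exact integral_nonneg_of_ae ((B.ae_coord_mem i j).mono fun v hv => hv.1)
  · have := integral_mono_ae (B.integrable_coord i j) (integrable_const (1 : ℝ))
      ((B.ae_coord_mem i j).mono fun v hv => hv.2)
    simpa [Instance.mean] using this

/-- The chord of the convex exponential is affine in `x`, so after integration only the mean
remains. This yields deviations that scale with the mean. -/
lemma exp_mul_le_of_mem_Icc {l x : ℝ} (hx : x ∈ Set.Icc (0 : ℝ) 1) :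
    Real.exp (l * x) ≤ 1 + x * (Real.exp l - 1) := by
  have := convexOn_exp.2 (Set.mem_univ 0) (Set.mem_univ l) (sub_nonneg.2 hx.2) hx.1 (by ring)
  simp only [smul_eq_mul, mul_zero, zero_add, Real.exp_zero, mul_one] at this
  rw [mul_comm]
  linarith

lemma Instance.lintegral_exp_le (l : ℝ) (j : Fin d) (i : Fin m) :
    ∫⁻ v, ENNReal.ofReal (Real.exp (l * v j)) ∂(B.law i) ≤
      ENNReal.ofReal (1 + B.mean j i * (Real.exp l - 1)) := by
  have := B.isProb i
  have hint : Integrable (fun v : Vec d => 1 + v j * (Real.exp l - 1)) (B.law i) :=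
    (integrable_const _).add ((B.integrable_coord i j).mul_const _)
  calc ∫⁻ v, ENNReal.ofReal (Real.exp (l * v j)) ∂(B.law i)
      ≤ ∫⁻ v, ENNReal.ofReal (1 + v j * (Real.exp l - 1)) ∂(B.law i) := by
        refine lintegral_mono_ae ?_
        filter_upwards [B.ae_coord_mem i j] with v hv
        exact ENNReal.ofReal_le_ofReal (exp_mul_le_of_mem_Icc hv)
    _ = ENNReal.ofReal (∫ v, (1 + v j * (Real.exp l - 1)) ∂(B.law i)) := by
        rw [ofReal_integral_eq_lintegral_ofReal hint]
        filter_upwards [B.ae_coord_mem i j] with v hv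
        exact (Real.exp_pos _).le.trans (exp_mul_le_of_mem_Icc hv)
    _ = _ := by
        rw [integral_add (integrable_const _) ((B.integrable_coord i j).mul_const _),
          integral_mul_const]
        simp [Instance.mean]

lemma one_add_mul_exp_sub_one_pos {l x : ℝ} (hx : x ∈ Set.Icc (0 : ℝ) 1) :
    0 ≤ 1 + x * (Real.exp l - 1) :=
  (Real.exp_pos _).le.trans (exp_mul_le_of_mem_Icc hx)

/-- Affinity in `q` collapses the sum over arms to its mean `a`. Then `1 + u ≤ exp u` and `exp (-l)
- 1 + l ≤ l ^ 2` finish, since `0 ≤ a ≤ 1`. -/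
lemma sum_exp_le_one {p q : Fin m → ℝ} (hp : p ∈ stdSimplex ℝ (Fin m))
    (hq : ∀ i, q i ∈ Set.Icc (0 : ℝ) 1) {l : ℝ} (hl : |l| ≤ 1) :
    ∑ i, p i * (Real.exp (l * (∑ i, p i * q i) - l ^ 2) * (1 + q i * (Real.exp (-l) - 1))) ≤ 1 := by
  set a := ∑ i, p i * q i with ha
  have ha0 : 0 ≤ a := Finset.sum_nonneg fun i _ => mul_nonneg (hp.1 i) (hq i).1
  have ha1 : a ≤ 1 := by
    rw [← hp.2]
    exact Finset.sum_le_sum fun i _ => mul_le_of_le_one_right (hp.1 i) (hq i).2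
  have e : ∑ i, p i * (Real.exp (l * a - l ^ 2) * (1 + q i * (Real.exp (-l) - 1))) =
      Real.exp (l * a - l ^ 2) * (1 + a * (Real.exp (-l) - 1)) := by
    have : ∀ i, p i * (Real.exp (l * a - l ^ 2) * (1 + q i * (Real.exp (-l) - 1))) =
        Real.exp (l * a - l ^ 2) * p i +
          Real.exp (l * a - l ^ 2) * (Real.exp (-l) - 1) * (p i * q i) := fun i => by ring
    simp_rw [this]
    rw [Finset.sum_add_distrib, ← Finset.mul_sum, ← Finset.mul_sum, hp.2, ← ha]
    ring
  rw [e]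
  have h1 := Real.abs_exp_sub_one_sub_id_le (x := -l) (by rwa [abs_neg])
  have h2 := (abs_le.1 h1).2
  calc Real.exp (l * a - l ^ 2) * (1 + a * (Real.exp (-l) - 1))
      ≤ Real.exp (l * a - l ^ 2) * Real.exp (a * (Real.exp (-l) - 1)) := by
        gcongr
        rw [add_comm]
        exact Real.add_one_le_exp _
    _ = Real.exp (a * (Real.exp (-l) - 1 - -l) - l ^ 2) := by
        rw [← Real.exp_add]
        ring_nf
    _ ≤ 1 := by
        rw [Real.exp_le_one_iff]
        nlinarith [sq_nonneg l]

end ExponentialMoments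

/-! ### The three kinds of deviation bounds. -/

section Deviations

variable {m d : ℕ} {B : Instance m d} {T : ℕ} {Ω : Type*} [mΩ : MeasurableSpace Ω]
  {P : Measure Ω} [IsProbabilityMeasure P]

lemma mixture_apply (M : Matrix (Fin d) (Fin m) ℝ) (p : Fin m → ℝ) (j : Fin d) :
    mixture M p j = ∑ i, p i * M j i := by
  simp [mixture, Matrix.mulVec, dotProduct, mul_comm]

/-- The deviation of the sum of the observations of arm `i` before round `t`. -/
lemma Play.measure_armSum_gt_le (X : Play B T P) (i : Fin m) (j : Fin d) {t : ℕ} (ht : t ≤ T)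
    (l r : ℝ) :
    P {ω | r < l * (∑ s ∈ (Finset.range t).filter (fun s => X.arm s ω = i), X.obs s ω j) -
      X.count t ω i * (B.mean j i * (Real.exp l - 1))} ≤ ENNReal.ofReal (Real.exp (-r)) := by
  set u := B.mean j i * (Real.exp l - 1) with hu
  have hu0 : 0 ≤ 1 + u := one_add_mul_exp_sub_one_pos (B.mean_mem j i)
  -- Rounds with another arm contribute the factor one; a round with arm `i` contributes at most
  -- `exp (-u) * (1 + u) ≤ 1`.
  have h := X.measure_sum_gt_le (α := fun _ i' _ => if i' = i then -u else 0)
    (fun _ _ _ => measurable_const) (β := fun i' v => if i' = i then l * v j else 0)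
    (fun i' => by
      split_ifs
      · exact (measurable_coord j).const_mul l
      · exact measurable_const)
    (b := fun i' => if i' = i then 1 + u else 1)
    (fun i' => by
      have := B.isProb i'
      split_ifs with h
      · subst h
        exact B.lintegral_exp_le l j i'
      · simp)
    (fun i' => by split_ifs <;> linarith)
    (fun s hs ω => by
      have hp := X.prob_mem s hs ω
      refine (Finset.sum_le_sum fun i' _ => mul_le_of_le_one_right (hp.1 i') ?_).trans hp.2.le
      split_ifs
      · calc Real.exp (-u) * (1 + u) ≤ Real.exp (-u) * Real.exp u := by
              gcongr
              rw [add_comm]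
              exact Real.add_one_le_exp u
          _ = 1 := by rw [← Real.exp_add]; simp
      · simp) ht r
  convert h using 5 with ω
  rw [Play.count, Finset.mul_sum, ← nsmul_eq_mul, ← Finset.sum_const, ← Finset.sum_sub_distrib,
    Finset.sum_filter]
  refine Finset.sum_congr rfl fun s _ => ?_
  split_ifs <;> ring

/-- The deviation of the sum of the observations from the sum of the conditional means. -/
lemma Play.measure_obsSum_gt_le (X : Play B T P) (j : Fin d) {l : ℝ} (hl : |l| ≤ 1) (r : ℝ) :
    P {ω | r < ∑ s ∈ Finset.range T,
      (l * (mixture B.mean (X.prob s ω) j - X.obs s ω j) - l ^ 2)} ≤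
      ENNReal.ofReal (Real.exp (-r)) := by
  have h := X.measure_sum_gt_le (t := T)
    (α := fun s _ ω => l * (∑ i, X.prob s ω i * B.mean j i) - l ^ 2)
    (fun s hs _ => by
      have := fun i => (X.prob_measurable s hs i).mul_const (B.mean j i)
      exact ((Finset.measurable_sum _ fun i _ => this i).const_mul l).sub_const _)
    (β := fun _ v => -l * v j) (fun _ => (measurable_coord j).const_mul _)
    (b := fun i => 1 + B.mean j i * (Real.exp (-l) - 1))
    (fun i => B.lintegral_exp_le (-l) j i)
    (fun i => one_add_mul_exp_sub_one_pos (B.mean_mem j i))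
    (fun s hs ω => sum_exp_le_one (X.prob_mem s hs ω) (B.mean_mem j) hl) le_rfl r
  convert h using 5 with ω
  refine Finset.sum_congr rfl fun s _ => ?_
  rw [mixture_apply]
  ring

/-- The deviation of predictable weights, evaluated at the played arm, from their conditional
means. -/
lemma Play.measure_weightSum_gt_le (X : Play B T P) {w : ℕ → Fin m → Ω → ℝ}
    (hw : ∀ t < T, ∀ i, Measurable[X.hist t] (w t i))
    (hw01 : ∀ t i ω, w t i ω ∈ Set.Icc (0 : ℝ) 1) {l : ℝ} (hl : |l| ≤ 1) (r : ℝ) :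
    P {ω | r < ∑ s ∈ Finset.range T,
      (l * ((∑ i, X.prob s ω i * w s i ω) - w s (X.arm s ω) ω) - l ^ 2)} ≤
      ENNReal.ofReal (Real.exp (-r)) := by
  -- Only the draw of the arm is random here, so the weight goes into `α` and `β` vanishes.
  have h := X.measure_sum_gt_le (t := T)
    (α := fun s i ω => (l * (∑ i, X.prob s ω i * w s i ω) - l ^ 2) + -l * w s i ω)
    (fun s hs i => by
      have := fun i => (X.prob_measurable s hs i).mul (hw s hs i)
      exact (((Finset.measurable_sum _ fun i _ => this i).const_mul l).sub_const _).add
        ((hw s hs i).const_mul _))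
    (β := fun _ _ => 0) (fun _ => measurable_const) (b := fun _ => 1)
    (fun i => by have := B.isProb i; simp) (fun _ => zero_le_one)
    (fun s hs ω => by
      refine le_trans (Finset.sum_le_sum fun i _ => ?_)
        (sum_exp_le_one (X.prob_mem s hs ω) (fun i => hw01 s i ω) hl)
      rw [Real.exp_add, mul_one]
      have := (X.prob_mem s hs ω).1 i
      gcongr
      exact exp_mul_le_of_mem_Icc (hw01 s i ω)) le_rfl r
  convert h using 5 with ω
  refine Finset.sum_congr rfl fun s _ => ?_
  ring

end Deviations

/-! ### From exponential bounds to explicit deviations. -/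

section RealEstimates

/-- The parameter of Chernoff's bound for the sum of the observations of an arm, if the mean of
the sum is `y`. -/
def chernoffParam (g y : ℝ) : ℝ := if g ≤ y then √(g / y) else 1

/-- The parameter of Chernoff's bound for a sum of `T` bounded martingale differences. -/
def azumaParam (g : ℝ) (T : ℕ) : ℝ := min 1 √(g / T)

lemma abs_chernoffParam_le_one {g y : ℝ} (hg : 0 < g) : |chernoffParam g y| ≤ 1 := by
  rw [chernoffParam]
  split_ifs with h
  · rw [abs_of_nonneg (Real.sqrt_nonneg _)]
    refine Real.sqrt_le_iff.2 ⟨zero_le_one, ?_⟩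
    rw [one_pow]
    exact (div_le_one (hg.trans_le h)).2 h
  · simp

lemma abs_azumaParam_le_one {g : ℝ} {T : ℕ} : |azumaParam g T| ≤ 1 := by
  rw [azumaParam, abs_of_nonneg (le_min zero_le_one (Real.sqrt_nonneg _))]
  exact min_le_left _ _

/-- The sign `ε` covers both tails. If `g ≤ y`, the parameter `√(g / y)` balances `g / l` against `y
* l`; otherwise `l = 1` costs `g + y ≤ 2 * g`. -/
lemma abs_sub_le_of_chernoff {g y S : ℝ} (hg : 0 < g) (hy : 0 ≤ y)
    (h : ∀ ε : ℤˣ, (ε * chernoffParam g y) * S - y * (Real.exp (ε * chernoffParam g y) - 1) ≤ g) :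
    |S - y| ≤ 2 * √(g * y) + 2 * g := by
  set l := chernoffParam g y with hl
  have hl1 : |l| ≤ 1 := abs_chernoffParam_le_one hg
  have hexp : ∀ a : ℝ, |a| ≤ 1 → y * (Real.exp a - 1) ≤ y * (a + a ^ 2) := fun a ha => by
    have := (abs_le.1 (Real.abs_exp_sub_one_sub_id_le ha)).2
    exact mul_le_mul_of_nonneg_left (by linarith) hy
  have hp := h 1
  have hm := h (-1)
  simp only [Units.val_one, Int.cast_one, one_mul, Units.val_neg, Int.cast_neg, neg_mul] at hp hm
  have h1 := hexp l hl1
  have h2 := hexp (-l) (by rwa [abs_neg])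
  have hp' : l * (S - y) ≤ g + y * l ^ 2 := by linarith
  have hm' : l * (y - S) ≤ g + y * l ^ 2 := by
    rw [neg_sq] at h2
    linarith
  have hs := Real.sqrt_nonneg (g * y)
  by_cases hgy : g ≤ y
  · have hy0 : 0 < y := hg.trans_le hgy
    have hl' : l = √(g / y) := by rw [hl, chernoffParam, if_pos hgy]
    have hl0 : 0 < l := hl' ▸ Real.sqrt_pos.2 (div_pos hg hy0)
    have hl2 : y * l ^ 2 = g := by
      rw [hl', Real.sq_sqrt (by positivity)]
      field_simp
    have hls : l * √(g * y) = g := by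
      rw [hl', ← Real.sqrt_mul (by positivity), show g / y * (g * y) = g ^ 2 by field_simp,
        Real.sqrt_sq hg.le]
    rw [hl2] at hp' hm'
    rw [abs_le]
    constructor
    · have : l * (y - S) ≤ l * (2 * √(g * y)) := by linarith
      have := le_of_mul_le_mul_left this hl0
      linarith
    · have : l * (S - y) ≤ l * (2 * √(g * y)) := by linarith
      have := le_of_mul_le_mul_left this hl0
      linarith
  · have hl' : l = 1 := by rw [hl, chernoffParam, if_neg hgy]
    rw [hl'] at hp' hm'
    rw [abs_le]
    constructor <;> linarith

/-- The confidence radius uses the empirical mean, whereas the deviation bound uses the true one.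
Completing the square exchanges `√((k + 1) ν)` for `√S + 3 √g`. The extra one in the denominator
costs `ν ≤ g`, and the factor `5` makes room for the resulting `9 * g`. -/
lemma abs_sub_le_two_rad {g ν S : ℝ} {k : ℕ} (hg : 1 ≤ g) (hν : ν ∈ Set.Icc (0 : ℝ) 1)
    (hS : 0 ≤ S) (h : |S - k * ν| ≤ 2 * √(g * (k * ν)) + 2 * g) :
    |ν - S / (k + 1)| ≤ 2 * rad (5 * g) (S / (k + 1)) (k + 1) := by
  obtain ⟨hν0, hν1⟩ := hν
  have hk : (0 : ℝ) < k + 1 := by positivity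
  set a := √g with ha
  set b := √((k + 1) * ν) with hb
  set c := √S with hc
  have ha0 : 0 ≤ a := Real.sqrt_nonneg _
  have hb0 : 0 ≤ b := Real.sqrt_nonneg _
  have hc0 : 0 ≤ c := Real.sqrt_nonneg _
  have ha2 : a ^ 2 = g := Real.sq_sqrt (by linarith)
  have hb2 : b ^ 2 = (k + 1) * ν := Real.sq_sqrt (by positivity)
  have hc2 : c ^ 2 = S := Real.sq_sqrt hS
  have h1 : √(g * (k * ν)) ≤ a * b := by
    rw [ha, hb, ← Real.sqrt_mul (by linarith)]
    gcongr
    linarith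
  have h2 := abs_le.1 h
  have hba : b ≤ c + 3 * a := by
    have : (b - a) ^ 2 ≤ (c + 2 * a) ^ 2 := by nlinarith [h2.1, mul_nonneg ha0 hc0]
    have := abs_le_of_sq_le_sq this (by positivity)
    linarith [le_abs_self (b - a)]
  have hab := mul_le_mul_of_nonneg_left hba ha0
  have hD : |(k + 1) * ν - S| ≤ 2 * (a * c) + 9 * a ^ 2 := by
    rw [abs_le]
    constructor <;> nlinarith [h2.1, h2.2]
  have hrad : (k + 1) * (2 * rad (5 * g) (S / (k + 1)) (k + 1)) = 2 * √(5 * g * S) + 10 * g := by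
    have : √(5 * g * (S / (k + 1)) / (k + 1)) = √(5 * g * S) / (k + 1) := by
      rw [show 5 * g * (S / ((k : ℝ) + 1)) / (k + 1) = 5 * g * S / (k + 1) ^ 2 by
        field_simp, Real.sqrt_div (by positivity), Real.sqrt_sq hk.le]
    rw [rad, this]
    field_simp
    ring
  have hac : a * c ≤ √(5 * g * S) := by
    rw [ha, hc, ← Real.sqrt_mul (by linarith)]
    gcongr
    linarith
  have e : |ν - S / (k + 1)| * (k + 1) = |(k + 1) * ν - S| := by
    rw [← abs_of_pos hk, ← abs_mul, abs_of_pos hk]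
    congr 1
    field_simp
  refine le_of_mul_le_mul_right ?_ hk
  rw [e, mul_comm (2 * rad _ _ _), hrad]
  linarith

/-- For `g ≤ T` the parameter balances the two terms; for `g > T` the trivial bound `T ≤ √(g T)` is
enough. -/
lemma sum_le_of_azuma {g : ℝ} {T : ℕ} (hg : 0 < g) (hT : 0 < T) {D : ℕ → ℝ}
    (hD : ∀ s < T, |D s| ≤ 1)
    (h : ∑ s ∈ Finset.range T, (azumaParam g T * D s - azumaParam g T ^ 2) ≤ g) :
    ∑ s ∈ Finset.range T, D s ≤ 2 * √(g * T) := by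
  have hT' : (0 : ℝ) < T := by exact_mod_cast hT
  rw [Finset.sum_sub_distrib, ← Finset.mul_sum, Finset.sum_const, Finset.card_range,
    nsmul_eq_mul] at h
  by_cases hgT : g ≤ T
  · have hl : azumaParam g T = √(g / T) := by
      rw [azumaParam, min_eq_right]
      refine Real.sqrt_le_iff.2 ⟨zero_le_one, ?_⟩
      rw [one_pow]
      exact (div_le_one hT').2 hgT
    have hl0 : 0 < √(g / T) := Real.sqrt_pos.2 (by positivity)
    have hls : √(g / T) * √(g * T) = g := by
      rw [← Real.sqrt_mul (by positivity), show g / T * (g * T) = g ^ 2 by field_simp,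
        Real.sqrt_sq hg.le]
    rw [hl, Real.sq_sqrt (by positivity), mul_div_cancel₀ _ hT'.ne'] at h
    refine le_of_mul_le_mul_left ?_ hl0
    linarith
  · calc ∑ s ∈ Finset.range T, D s ≤ ∑ s ∈ Finset.range T, (1 : ℝ) :=
          Finset.sum_le_sum fun s hs => (abs_le.1 (hD s (Finset.mem_range.1 hs))).2
      _ = T := by simp
      _ = √(T * T) := (Real.sqrt_mul_self hT'.le).symm
      _ ≤ √(g * T) := by gcongr; linarith
      _ ≤ 2 * √(g * T) := by linarith [Real.sqrt_nonneg (g * T)]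

end RealEstimates

/-! ### Sums of inverse square roots of play counts. -/

section Counting

variable {m : ℕ}

lemma inv_sqrt_succ_le (k : ℕ) : (√((k : ℝ) + 1))⁻¹ ≤ 2 * (√((k : ℝ) + 1) - √k) := by
  have h1 : 0 < √((k : ℝ) + 1) := Real.sqrt_pos.2 (by positivity)
  have h2 := Real.sqrt_nonneg (k : ℝ)
  have h3 : √((k : ℝ) + 1) ^ 2 = k + 1 := Real.sq_sqrt (by positivity)
  have h4 : √(k : ℝ) ^ 2 = k := Real.sq_sqrt (by positivity)
  rw [inv_le_iff_one_le_mul₀ h1]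
  nlinarith [sq_nonneg (√((k : ℝ) + 1) - √k)]

/-- Playing an arm raises only its own count, so each summand is paid for by the increment of that
arm's square root. -/
lemma sum_inv_sqrt_count_le (arm : ℕ → Fin m) (n : ℕ) :
    ∑ t ∈ Finset.range n,
      (√((((Finset.range t).filter fun s => arm s = arm t).card : ℝ) + 1))⁻¹ ≤
    2 * ∑ i, √(((Finset.range n).filter fun s => arm s = i).card : ℝ) := by
  induction n with
  | zero => simp
  | succ n ih =>
    rw [Finset.sum_range_succ]
    have h1 : ∑ i, √(((Finset.range (n + 1)).filter fun s => arm s = i).card : ℝ) =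
        ∑ i, (√(((Finset.range n).filter fun s => arm s = i).card : ℝ) +
          if arm n = i then
            √((((Finset.range n).filter fun s => arm s = arm n).card : ℝ) + 1) -
              √(((Finset.range n).filter fun s => arm s = arm n).card : ℝ) else 0) := by
      refine Finset.sum_congr rfl fun i _ => ?_
      rw [Finset.range_add_one, Finset.filter_insert]
      split_ifs with h
      · subst h
        rw [Finset.card_insert_of_notMem (by simp)]
        push_cast
        ring
      · simp
    rw [h1, Finset.sum_add_distrib, Finset.sum_ite_eq]
    have h2 := inv_sqrt_succ_le ((Finset.range n).filter fun s => arm s = arm n).card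
    simp only [Finset.mem_univ, if_true]
    linarith

lemma sum_sqrt_count_le (arm : ℕ → Fin m) (n : ℕ) :
    ∑ i, √(((Finset.range n).filter fun s => arm s = i).card : ℝ) ≤ √((m : ℝ) * n) := by
  refine Real.le_sqrt_of_sq_le ?_
  refine (sq_sum_le_card_mul_sum_sq).trans_eq ?_
  simp_rw [Real.sq_sqrt (Nat.cast_nonneg _)]
  rw [← Nat.cast_sum, ← Finset.card_eq_sum_card_fiberwise
    fun _ _ => Finset.mem_coe.2 (Finset.mem_univ _)]
  simp

end Counting

/-! ### The typical event and its probability. -/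

section GoodEvent

variable {m d : ℕ} {B : Instance m d} {T : ℕ} {Ω : Type*} [mΩ : MeasurableSpace Ω]
  {P : Measure Ω}

/-- An upper bound on the widths of the confidence intervals of arm `i`. -/
def Play.width (X : Play B T P) (γ : ℝ) (t : ℕ) (i : Fin m) (ω : Ω) : ℝ :=
  min 1 (8 * (√γ * (√(X.count t ω i + 1))⁻¹))

lemma Play.width_mem (X : Play B T P) (γ : ℝ) (t : ℕ) (i : Fin m) (ω : Ω) :
    X.width γ t i ω ∈ Set.Icc (0 : ℝ) 1 :=
  ⟨le_min zero_le_one (by positivity), min_le_left _ _⟩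

lemma Play.measurable_count (X : Play B T P) {t : ℕ} (ht : t ≤ T) (i : Fin m) :
    Measurable[X.hist t] fun ω => (X.count t ω i : ℝ) := by
  have h : ∀ ω, (X.count t ω i : ℝ) =
      ∑ s ∈ Finset.range t, if X.arm s ω = i then (1 : ℝ) else 0 := by
    intro ω
    simp [Play.count]
  simp_rw [h]
  refine Finset.measurable_sum _ fun s hs => ?_
  have := X.arm_measurable_of_lt (Finset.mem_range.1 hs) ht
  exact Measurable.ite (this (measurableSet_singleton i)) measurable_const measurable_const

lemma Play.measurable_width (X : Play B T P) (γ : ℝ) {t : ℕ} (ht : t ≤ T) (i : Fin m) :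
    Measurable[X.hist t] (X.width γ t i) := by
  have := X.measurable_count ht i
  exact measurable_const.min (((((this.add_const 1).sqrt).inv).const_mul _).const_mul _)

/-- The outcomes for which none of the sums that matter deviates much from its mean. -/
structure Play.IsTypical (X : Play B T P) (g γ : ℝ) (ω : Ω) : Prop where
  armSum : ∀ (i : Fin m) (j : Fin d), ∀ t < T, ∀ k < T, ∀ ε : ℤˣ,
    (ε * chernoffParam g (k * B.mean j i)) *
      (∑ s ∈ (Finset.range t).filter (fun s => X.arm s ω = i), X.obs s ω j) -
      X.count t ω i * (B.mean j i * (Real.exp (ε * chernoffParam g (k * B.mean j i)) - 1)) ≤ g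
  obsSum : ∀ (j : Fin d) (ε : ℤˣ), ∑ s ∈ Finset.range T,
    (ε * azumaParam g T * (mixture B.mean (X.prob s ω) j - X.obs s ω j) -
      (ε * azumaParam g T) ^ 2) ≤ g
  weightSum : ∑ s ∈ Finset.range T, (azumaParam g T *
    ((∑ i, X.prob s ω i * X.width γ s i ω) - X.width γ s (X.arm s ω) ω) - azumaParam g T ^ 2) ≤ g
  obs_mem : ∀ s < T, X.obs s ω ∈ cube d

lemma abs_sign_mul (ε : ℤˣ) (x : ℝ) : |(ε : ℝ) * x| = |x| := by
  rcases Int.units_eq_one_or ε with h | h <;> simp [h]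

lemma Play.measure_not_isTypical_le [IsProbabilityMeasure P] (X : Play B T P) (g γ : ℝ) :
    P {ω | ¬ X.IsTypical g γ ω} ≤
      ENNReal.ofReal ((2 * m * d * T * T + 2 * d + 1) * Real.exp (-g)) := by
  set e := ENNReal.ofReal (Real.exp (-g)) with he
  let E₁ : Fin m × Fin d × Fin T × Fin T × ℤˣ → Set Ω := fun q =>
    {ω | g < (q.2.2.2.2 * chernoffParam g (q.2.2.2.1 * B.mean q.2.1 q.1)) *
      (∑ s ∈ (Finset.range q.2.2.1).filter (fun s => X.arm s ω = q.1), X.obs s ω q.2.1) -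
      X.count q.2.2.1 ω q.1 * (B.mean q.2.1 q.1 *
        (Real.exp (q.2.2.2.2 * chernoffParam g (q.2.2.2.1 * B.mean q.2.1 q.1)) - 1))}
  let E₂ : Fin d × ℤˣ → Set Ω := fun q =>
    {ω | g < ∑ s ∈ Finset.range T,
      (q.2 * azumaParam g T * (mixture B.mean (X.prob s ω) q.1 - X.obs s ω q.1) -
        (q.2 * azumaParam g T) ^ 2)}
  let E₃ : Set Ω := {ω | g < ∑ s ∈ Finset.range T, (azumaParam g T *
    ((∑ i, X.prob s ω i * X.width γ s i ω) - X.width γ s (X.arm s ω) ω) - azumaParam g T ^ 2)}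
  let E₄ : Set Ω := {ω | ¬ ∀ s < T, X.obs s ω ∈ cube d}
  have h₁ : P (⋃ q, E₁ q) ≤ (2 * m * d * T * T : ℕ) * e := by
    refine (measure_iUnion_fintype_le P E₁).trans ((Finset.sum_le_sum fun q _ =>
      X.measure_armSum_gt_le q.1 q.2.1 q.2.2.1.2.le _ g).trans_eq ?_)
    rw [Finset.sum_const, Finset.card_univ, nsmul_eq_mul]
    congr 2
    simp only [Fintype.card_prod, Fintype.card_fin, Fintype.card_units_int]
    ring
  have h₂ : P (⋃ q, E₂ q) ≤ (2 * d : ℕ) * e := by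
    refine (measure_iUnion_fintype_le P E₂).trans ((Finset.sum_le_sum fun q _ =>
      X.measure_obsSum_gt_le q.1 ?_ g).trans_eq ?_)
    · rw [abs_sign_mul]
      exact abs_azumaParam_le_one
    · rw [Finset.sum_const, Finset.card_univ, nsmul_eq_mul]
      congr 2
      simp only [Fintype.card_prod, Fintype.card_fin, Fintype.card_units_int]
      ring
  have h₃ : P E₃ ≤ e := X.measure_weightSum_gt_le
    (fun t ht i => X.measurable_width γ ht.le i) (fun t i ω => X.width_mem γ t i ω)
    abs_azumaParam_le_one g
  have h₄ : P E₄ = 0 := X.ae_forall_obs_mem_cube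
  have hsub : {ω | ¬ X.IsTypical g γ ω} ⊆ ((⋃ q, E₁ q) ∪ (⋃ q, E₂ q)) ∪ (E₃ ∪ E₄) := by
    intro ω hω
    by_contra hn
    simp only [Set.mem_union, Set.mem_iUnion, not_or, not_exists] at hn
    obtain ⟨⟨n₁, n₂⟩, n₃, n₄⟩ := hn
    refine hω ⟨fun i j t ht k hk ε => ?_, fun j ε => ?_, not_lt.1 n₃, not_not.1 n₄⟩
    · exact not_lt.1 (n₁ (i, j, ⟨t, ht⟩, ⟨k, hk⟩, ε))
    · exact not_lt.1 (n₂ (j, ε))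
  calc P {ω | ¬ X.IsTypical g γ ω}
      ≤ (P (⋃ q, E₁ q) + P (⋃ q, E₂ q)) + (P E₃ + P E₄) :=
        (measure_mono hsub).trans ((measure_union_le _ _).trans
          (add_le_add (measure_union_le _ _) (measure_union_le _ _)))
    _ ≤ ((2 * m * d * T * T : ℕ) * e + (2 * d : ℕ) * e) + (e + 0) := by
        rw [h₄]
        gcongr
    _ = (2 * m * d * T * T + 2 * d + 1 : ℕ) * e := by
        push_cast
        ring
    _ = _ := by
        rw [he, ← ENNReal.ofReal_natCast, ← ENNReal.ofReal_mul (by positivity)]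
        push_cast
        rfl

/-- With `n = n₁ n₂ n₃` there are at most `5 n ^ 2` events. The condition `25 ≤ c` gives `g ≥ 5 log
(n / δ)`, so each has probability at most `(δ / n) ^ 5`; the total `5 δ ^ 5 / n ^ 3` is below `δ`
because `n ≥ 2`. -/
lemma union_bound_le {n₁ n₂ n₃ : ℕ} (hn : 2 ≤ n₁ * n₂ * n₃) {δ c g : ℝ} (hδ : 0 < δ) (hδ1 : δ < 1)
    (hc : 25 ≤ c) (hg : g = c * Real.log ((n₁ : ℝ) * n₂ * n₃ / δ) / 5) :
    1 ≤ g ∧ (2 * n₁ * n₃ * n₂ * n₂ + 2 * n₃ + 1) * Real.exp (-g) ≤ δ := by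
  have hpos : 0 < n₁ * n₂ * n₃ := by omega
  have h1 : 1 ≤ n₁ := Nat.pos_of_ne_zero (by rintro rfl; simp at hpos)
  have h2 : 1 ≤ n₂ := Nat.pos_of_ne_zero (by rintro rfl; simp at hpos)
  have h3 : 1 ≤ n₃ := Nat.pos_of_ne_zero (by rintro rfl; simp at hpos)
  have h1' : (1 : ℝ) ≤ n₁ := by exact_mod_cast h1
  have h2' : (1 : ℝ) ≤ n₂ := by exact_mod_cast h2
  have h3' : (1 : ℝ) ≤ n₃ := by exact_mod_cast h3
  set n : ℝ := (n₁ : ℝ) * n₂ * n₃ with hn'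
  have hn2 : 2 ≤ n := by rw [hn']; exact_mod_cast hn
  have hx2 : 2 ≤ n / δ := by
    rw [le_div_iff₀ hδ]
    nlinarith
  have hlog : 1 / 2 < Real.log (n / δ) := by
    have := Real.log_le_log (by norm_num) hx2
    linarith [Real.log_two_gt_d9]
  have hg5 : 5 * Real.log (n / δ) ≤ g := by
    rw [hg]
    nlinarith
  refine ⟨by linarith, ?_⟩
  have hexp : Real.exp (-g) ≤ (δ / n) ^ 5 := by
    have hx : 0 < n / δ := by linarith
    calc Real.exp (-g) ≤ Real.exp (-(5 * Real.log (n / δ))) := by gcongr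
      _ = (δ / n) ^ 5 := by
        rw [show -(5 * Real.log (n / δ)) = (5 : ℕ) * Real.log (δ / n) by
          rw [← inv_div, Real.log_inv]; push_cast; ring, Real.exp_nat_mul,
          Real.exp_log (by positivity)]
  have hd : (n₃ : ℝ) ≤ n := by
    rw [hn']
    exact le_mul_of_one_le_left (by linarith) (one_le_mul_of_one_le_of_one_le h1' h2')
  have hm : (n₁ : ℝ) * n₃ * n₂ * n₂ ≤ n ^ 2 := by
    calc (n₁ : ℝ) * n₃ * n₂ * n₂ = n * n₂ := by rw [hn']; ring
      _ ≤ n * n := by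
        gcongr
        rw [hn']
        nlinarith [mul_le_mul h1' h3' zero_le_one (by linarith : (0 : ℝ) ≤ n₁)]
      _ = n ^ 2 := (sq n).symm
  calc (2 * (n₁ : ℝ) * n₃ * n₂ * n₂ + 2 * n₃ + 1) * Real.exp (-g)
      ≤ (5 * n ^ 2) * (δ / n) ^ 5 := by
        gcongr
        nlinarith
    _ = 5 * δ ^ 5 / n ^ 3 := by field_simp
    _ ≤ δ := by
        have h8 : (2 : ℝ) ^ 3 ≤ n ^ 3 := by gcongr
        have hδ5 : δ ^ 5 ≤ δ := by
          simpa using pow_le_pow_of_le_one hδ.le hδ1.le (show 1 ≤ 5 by norm_num)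
        rw [div_le_iff₀ (by positivity)]
        nlinarith

end GoodEvent

variable {m d : ℕ} {B : Instance m d} {T : ℕ} {Ω : Type*} [mΩ : MeasurableSpace Ω]
  {P : Measure Ω}

lemma mixture_mem_cube {M : Matrix (Fin d) (Fin m) ℝ} (hM : ∀ j i, M j i ∈ Set.Icc (0 : ℝ) 1)
    {p : Fin m → ℝ} (hp : p ∈ stdSimplex ℝ (Fin m)) : mixture M p ∈ cube d := by
  intro j
  rw [mixture_apply]
  constructor
  · exact Finset.sum_nonneg fun i _ => mul_nonneg (hp.1 i) (hM j i).1
  · rw [← hp.2]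
    exact Finset.sum_le_sum fun i _ => mul_le_of_le_one_right (hp.1 i) (hM j i).2

lemma average_mem {E : Type*} [AddCommGroup E] [Module ℝ E] {s : Set E} (hs : Convex ℝ s) {n : ℕ}
    (hn : 0 < n) {x : ℕ → E} (hx : ∀ t < n, x t ∈ s) :
    (n : ℝ)⁻¹ • ∑ t ∈ Finset.range n, x t ∈ s := by
  rw [Finset.smul_sum]
  refine hs.sum_mem (fun _ _ => by positivity) ?_ fun t ht => hx t (Finset.mem_range.1 ht)
  have : (n : ℝ) ≠ 0 := by exact_mod_cast hn.ne'
  simp [this]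

/-! ### Deterministic analysis on typical outcomes. -/

section Pathwise

variable {X : Play B T P} {est : ℕ → Ω → Matrix (Fin d) (Fin m) ℝ} {g γ : ℝ} {ω : Ω}

lemma Play.emp_mem (hobs : ∀ s < T, X.obs s ω ∈ cube d) {t : ℕ} (ht : t ≤ T)
    (j : Fin d) (i : Fin m) :
    X.emp t ω j i ∈ Set.Icc (0 : ℝ) 1 := by
  have h : ∀ s ∈ (Finset.range t).filter (fun s => X.arm s ω = i),
      X.obs s ω j ∈ Set.Icc (0 : ℝ) 1 := fun s hs =>
    hobs s ((Finset.mem_range.1 (Finset.mem_filter.1 hs).1).trans_le ht) j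
  rw [Play.emp]
  constructor
  · exact div_nonneg (Finset.sum_nonneg fun s hs => (h s hs).1) (by positivity)
  · rw [div_le_one (by positivity)]
    refine (Finset.sum_le_sum fun s hs => (h s hs).2).trans ?_
    simp [Play.count]

lemma Play.IsTypical.mean_mem_confBox (hX : X.IsTypical g γ ω) (hg : 1 ≤ g) {t : ℕ} (ht : t < T) :
    B.mean ∈ X.confBox (5 * g) t ω := by
  intro j i
  have hν := B.mean_mem j i
  have hk : X.count t ω i < T := by
    refine lt_of_le_of_lt ?_ ht
    simpa [Play.count] using Finset.card_filter_le (Finset.range t) fun s => X.arm s ω = i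
  have hS : 0 ≤ ∑ s ∈ (Finset.range t).filter (fun s => X.arm s ω = i), X.obs s ω j :=
    Finset.sum_nonneg fun s hs =>
      (hX.obs_mem s ((Finset.mem_range.1 (Finset.mem_filter.1 hs).1).trans ht) j).1
  -- The Chernoff parameter must be fixed beforehand although the count is random; the typical event
  -- covers all `k < T`, so `k` may be set to the actual count.
  have h := abs_sub_le_two_rad hg hν hS (abs_sub_le_of_chernoff (by linarith)
    (mul_nonneg (Nat.cast_nonneg _) hν.1) fun ε => by
      have := hX.armSum i j t ht _ hk ε
      rwa [← mul_assoc] at this)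
  rw [abs_le] at h
  simp only [Play.lcb, Play.ucb, Play.emp]
  exact ⟨max_le hν.1 (by linarith), le_min hν.2 (by linarith)⟩

lemma Play.mem_Icc_of_mem_confBox {t : ℕ} {M : Matrix (Fin d) (Fin m) ℝ}
    (hM : M ∈ X.confBox γ t ω) (j : Fin d) (i : Fin m) : M j i ∈ Set.Icc (0 : ℝ) 1 :=
  ⟨(le_max_left _ _).trans (hM j i).1, (hM j i).2.trans (min_le_left _ _)⟩

/-- The interval has length at most four radii. If `γ ≤ N`, each of the two terms of the radius is
at most `√(γ / N)`, whence the factor `8`; if `γ > N`, the trivial bound one is smaller. -/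
lemma Play.abs_sub_le_width (hobs : ∀ s < T, X.obs s ω ∈ cube d) (hγ : 0 ≤ γ)
    {t : ℕ} (ht : t ≤ T) {M M' : Matrix (Fin d) (Fin m) ℝ} (hM : M ∈ X.confBox γ t ω)
    (hM' : M' ∈ X.confBox γ t ω) (j : Fin d) (i : Fin m) :
    |M j i - M' j i| ≤ X.width γ t i ω := by
  have h1 := Play.mem_Icc_of_mem_confBox hM j i
  have h2 := Play.mem_Icc_of_mem_confBox hM' j i
  obtain ⟨he0, he1⟩ := Play.emp_mem hobs ht j i
  have hle : |M j i - M' j i| ≤ 1 := by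
    rw [abs_le]
    constructor <;> linarith [h1.1, h1.2, h2.1, h2.2]
  refine le_min hle ?_
  set N : ℝ := (X.count t ω i : ℝ) + 1 with hN
  have hN0 : 0 < N := by positivity
  have hrad : |M j i - M' j i| ≤ 4 * rad γ (X.emp t ω j i) N := by
    have a1 := (le_max_right _ _).trans (hM j i).1
    have a2 := (hM j i).2.trans (min_le_right _ _)
    have a3 := (le_max_right _ _).trans (hM' j i).1
    have a4 := (hM' j i).2.trans (min_le_right _ _)
    rw [abs_le]
    constructor <;> linarith
  have hs : √γ * (√N)⁻¹ = √(γ / N) := by rw [Real.sqrt_div hγ, div_eq_mul_inv]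
  rw [hs]
  by_cases hγN : γ / N ≤ 1
  · have b0 : 0 ≤ γ / N := by positivity
    have b1 : γ / N ≤ √(γ / N) := by
      refine Real.le_sqrt_of_sq_le ?_
      nlinarith
    have b2 : √(γ * X.emp t ω j i / N) ≤ √(γ / N) := by
      gcongr
      exact mul_le_of_le_one_right hγ he1
    rw [rad] at hrad
    linarith
  · have : 1 ≤ √(γ / N) := Real.one_le_sqrt.2 (not_le.1 hγN).le
    linarith

lemma Play.sum_width_le (hγ : 0 ≤ γ) :
    ∑ s ∈ Finset.range T, X.width γ s (X.arm s ω) ω ≤ 16 * √(γ * m * T) := by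
  calc ∑ s ∈ Finset.range T, X.width γ s (X.arm s ω) ω
      ≤ ∑ s ∈ Finset.range T, 8 * (√γ * (√((X.count s ω (X.arm s ω) : ℝ) + 1))⁻¹) :=
        Finset.sum_le_sum fun s _ => min_le_right _ _
    _ = 8 * (√γ * ∑ s ∈ Finset.range T, (√((X.count s ω (X.arm s ω) : ℝ) + 1))⁻¹) := by
        rw [Finset.mul_sum, Finset.mul_sum]
    _ ≤ 8 * (√γ * (2 * √((m : ℝ) * T))) := by
        gcongr
        have h1 := sum_inv_sqrt_count_le (fun s => X.arm s ω) T
        have h2 := sum_sqrt_count_le (fun s => X.arm s ω) T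
        refine h1.trans ?_
        linarith
    _ = 16 * √(γ * m * T) := by
        rw [mul_assoc γ, Real.sqrt_mul hγ]
        ring

/-- On typical outcomes the average estimate is close to the average observation. -/
lemma Play.IsTypical.norm_avgEst_sub_avgObs_le (hX : X.IsTypical g (5 * g) ω) (hg : 1 ≤ g)
    (hT : 0 < T) (hm : 0 < m) {x₀ : Vec d} (hest : ∀ t < T, est t ω ∈ X.confBox (5 * g) t ω) :
    ‖X.avgEst est x₀ T ω - X.avgObs ω‖ ≤ 20 * (√d * √(5 * g * m / T)) := by
  have hT' : (0 : ℝ) < T := by exact_mod_cast hT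
  have hm' : (1 : ℝ) ≤ m := by exact_mod_cast hm
  have hg0 : 0 < g := by linarith
  have hsq : √(g * T) ≤ √(5 * g * m * T) := by
    gcongr
    nlinarith
  have hobs : ∀ j, |∑ s ∈ Finset.range T, (mixture B.mean (X.prob s ω) j - X.obs s ω j)| ≤
      2 * √(g * T) := by
    intro j
    have hD : ∀ s < T, |mixture B.mean (X.prob s ω) j - X.obs s ω j| ≤ 1 := by
      intro s hs
      have h1 := mixture_mem_cube B.mean_mem (X.prob_mem s hs ω) j
      have h2 := hX.obs_mem s hs j
      rw [abs_le]
      constructor <;> linarith [h1.1, h1.2, h2.1, h2.2]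
    have hp := sum_le_of_azuma hg0 hT hD (by simpa using hX.obsSum j 1)
    have hm := sum_le_of_azuma hg0 hT
      (D := fun s => -(mixture B.mean (X.prob s ω) j - X.obs s ω j))
      (fun s hs => by simpa only [abs_neg] using hD s hs)
      (by
        have := hX.obsSum j (-1)
        simpa only [Units.val_neg, Units.val_one, Int.cast_neg, Int.cast_one, neg_mul, one_mul,
          neg_sq, mul_neg] using this)
    rw [Finset.sum_neg_distrib] at hm
    rw [abs_le]
    constructor <;> linarith
  -- Widths averaged over `p_t` are compared with widths at the played arms, since only the latter
  -- can be counted.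
  have hw : ∑ s ∈ Finset.range T, ∑ i, X.prob s ω i * X.width (5 * g) s i ω ≤
      16 * √(5 * g * m * T) + 2 * √(g * T) := by
    have h := sum_le_of_azuma hg0 hT (fun s hs => by
      have h1 := X.width_mem (5 * g) s (X.arm s ω) ω
      have hp := X.prob_mem s hs ω
      have h2 : 0 ≤ ∑ i, X.prob s ω i * X.width (5 * g) s i ω :=
        Finset.sum_nonneg fun i _ => mul_nonneg (hp.1 i) (X.width_mem _ s i ω).1
      have h3 : ∑ i, X.prob s ω i * X.width (5 * g) s i ω ≤ 1 := by
        rw [← hp.2]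
        exact Finset.sum_le_sum fun i _ =>
          mul_le_of_le_one_right (hp.1 i) (X.width_mem _ s i ω).2
      rw [abs_le]
      constructor <;> linarith [h1.1, h1.2]) hX.weightSum
    rw [Finset.sum_sub_distrib] at h
    have := Play.sum_width_le (X := X) (ω := ω) (γ := 5 * g) (by linarith)
    linarith
  have hdiff : ∀ j, |∑ s ∈ Finset.range T,
      (mixture (est s ω) (X.prob s ω) j - mixture B.mean (X.prob s ω) j)| ≤
      16 * √(5 * g * m * T) + 2 * √(g * T) := by
    intro j
    refine ((Finset.abs_sum_le_sum_abs _ _).trans (Finset.sum_le_sum fun s hs => ?_)).trans hw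
    have hs := Finset.mem_range.1 hs
    rw [mixture_apply, mixture_apply, ← Finset.sum_sub_distrib]
    refine (Finset.abs_sum_le_sum_abs _ _).trans (Finset.sum_le_sum fun i _ => ?_)
    have hp := (X.prob_mem s hs ω).1 i
    rw [← mul_sub, abs_mul, abs_of_nonneg hp]
    exact mul_le_mul_of_nonneg_left (Play.abs_sub_le_width hX.obs_mem (by linarith) hs.le
      (hest s hs) (hX.mean_mem_confBox hg hs) j i) hp
  -- The constant is `20 = 16 + 2 + 2`: widths at played arms, arm-draw noise, observation noise.
  have hcoord : ∀ j, |(∑ s ∈ Finset.range T,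
      (mixture (est s ω) (X.prob s ω) - X.obs s ω)) j| ≤ 20 * √(5 * g * m * T) := by
    intro j
    have e : (∑ s ∈ Finset.range T, (mixture (est s ω) (X.prob s ω) - X.obs s ω)) j =
        ∑ s ∈ Finset.range T,
          (mixture (est s ω) (X.prob s ω) j - mixture B.mean (X.prob s ω) j) +
        ∑ s ∈ Finset.range T, (mixture B.mean (X.prob s ω) j - X.obs s ω j) := by
      rw [← Finset.sum_add_distrib]
      simp
    rw [e]
    refine (abs_add_le _ _).trans ?_
    linarith [hdiff j, hobs j]
  have hn := norm_le_of_coord_le (by positivity) hcoord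
  rw [Play.avgEst, if_neg hT.ne', Play.avgObs, ← smul_sub, ← Finset.sum_sub_distrib, norm_smul,
    Real.norm_of_nonneg (by positivity)]
  have hst : (T : ℝ)⁻¹ * √(5 * g * m * T) = √(5 * g * m / T) := by
    rw [← Real.sqrt_sq (inv_nonneg.2 hT'.le), ← Real.sqrt_mul (by positivity)]
    congr 1
    field_simp
  calc (T : ℝ)⁻¹ * ‖∑ s ∈ Finset.range T, (mixture (est s ω) (X.prob s ω) - X.obs s ω)‖
      ≤ (T : ℝ)⁻¹ * (√d * (20 * √(5 * g * m * T))) := by gcongr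
    _ = 20 * (√d * ((T : ℝ)⁻¹ * √(5 * g * m * T))) := by ring
    _ = _ := by rw [hst]

lemma smoothingParam_sq {d T : ℕ} (hT : 0 < T) :
    smoothingParam d T ^ 2 = (d : ℝ) / T * (1 + Real.log T / Real.log 2) := by
  have hT' : (1 : ℝ) ≤ T := by exact_mod_cast hT
  have hl2 : 0 < Real.log 2 := Real.log_pos (by norm_num)
  have e : Real.logb 2 (2 * T) = 1 + Real.log T / Real.log 2 := by
    rw [Real.logb, Real.log_mul (by norm_num) (by linarith), add_div, div_self hl2.ne']
  have : 0 ≤ Real.log T := Real.log_nonneg hT'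
  rw [smoothingParam, Real.sq_sqrt, e]
  rw [e]
  positivity

lemma smoothingParam_pos {d T : ℕ} (hd : 0 < d) (hT : 0 < T) : 0 < smoothingParam d T := by
  have hT' : (1 : ℝ) ≤ T := by exact_mod_cast hT
  have hd' : (0 : ℝ) < d := by exact_mod_cast hd
  exact Real.sqrt_pos.2 (mul_pos (by positivity) (Real.logb_pos (by norm_num) (by linarith)))

lemma smoothingParam_le {d T : ℕ} (hT : 0 < T) :
    smoothingParam d T ≤ √((d : ℝ) / T) + 2 * √(d * Real.log T / T) := by
  have hT' : (1 : ℝ) ≤ T := by exact_mod_cast hT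
  have hlog : 0 ≤ Real.log T := Real.log_nonneg hT'
  have hl2 : 1 / 4 ≤ Real.log 2 := by linarith [Real.log_two_gt_d9]
  refine abs_le_of_sq_le_sq' ?_ (by positivity) |>.2
  rw [smoothingParam_sq hT]
  have h1 : √((d : ℝ) / T) ^ 2 = d / T := Real.sq_sqrt (by positivity)
  have h2 : √(d * Real.log T / T) ^ 2 = d * Real.log T / T := Real.sq_sqrt (by positivity)
  have h3 := mul_nonneg (Real.sqrt_nonneg ((d : ℝ) / T)) (Real.sqrt_nonneg (d * Real.log T / T))
  have h4 : (d : ℝ) / T * (1 + Real.log T / Real.log 2) ≤ d / T + 4 * (d * Real.log T / T) := by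
    have : Real.log T / Real.log 2 ≤ 4 * Real.log T := by
      rw [div_le_iff₀ (by linarith)]
      nlinarith
    calc (d : ℝ) / T * (1 + Real.log T / Real.log 2) ≤ (d : ℝ) / T * (1 + 4 * Real.log T) := by
          gcongr
      _ = _ := by ring
  nlinarith

lemma avgEst_mem_cube {x₀ : Vec d} (hx₀ : x₀ ∈ cube d)
    (hest : ∀ t < T, est t ω ∈ X.confBox γ t ω) {t : ℕ} (ht : t ≤ T) :
    X.avgEst est x₀ t ω ∈ cube d := by
  rw [Play.avgEst]
  split_ifs with h
  · exact hx₀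
  · exact average_mem (convex_cube d) (Nat.pos_of_ne_zero h) fun s hs =>
      mixture_mem_cube (Play.mem_Icc_of_mem_confBox (hest s (hs.trans_le ht)))
        (X.prob_mem s (hs.trans_le ht) ω)

lemma Play.avgEst_succ (X : Play B T P) (est : ℕ → Ω → Matrix (Fin d) (Fin m) ℝ) (x₀ : Vec d)
    (t : ℕ) (ω : Ω) :
    ((t : ℝ) + 1) • (X.avgEst est x₀ (t + 1) ω - X.avgEst est x₀ t ω) =
      mixture (est t ω) (X.prob t ω) - X.avgEst est x₀ t ω := by
  have h1 : ((t : ℝ) + 1) ≠ 0 := by positivity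
  have h2 : ((t : ℝ) + 1) • X.avgEst est x₀ (t + 1) ω =
      ∑ s ∈ Finset.range t, mixture (est s ω) (X.prob s ω) + mixture (est t ω) (X.prob t ω) := by
    rw [Play.avgEst, if_neg t.succ_ne_zero, Finset.sum_range_succ, smul_smul]
    push_cast
    rw [mul_inv_cancel₀ h1, one_smul]
  have h3 : (t : ℝ) • X.avgEst est x₀ t ω =
      ∑ s ∈ Finset.range t, mixture (est s ω) (X.prob s ω) := by
    -- At `t = 0` the prescribed starting point has weight zero.
    rcases Nat.eq_zero_or_pos t with rfl | ht
    · simp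
    · have ht' : (t : ℝ) ≠ 0 := by exact_mod_cast ht.ne'
      rw [Play.avgEst, if_neg ht.ne', smul_smul, mul_inv_cancel₀ ht', one_smul]
  rw [smul_sub, h2, add_smul, h3, one_smul]
  abel

lemma Play.avgObs_mem_cube (hT : 0 < T) (hobs : ∀ s < T, X.obs s ω ∈ cube d) :
    X.avgObs ω ∈ cube d :=
  average_mem (convex_cube d) hT hobs

/-- On typical outcomes the primal algorithm competes with every fixed distribution. -/
lemma Play.IsTypical.regret_le (hX : X.IsTypical g (5 * g) ω) (hg : 1 ≤ g)
    (hT : 0 < T) (hm : 0 < m) (hd : 0 < d) {x₀ : Vec d} (hx₀ : x₀ ∈ cube d)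
    {f : Vec d → ℝ} {L : ℝ} (hL : 0 < L) (hf : ConcaveOn ℝ (cube d) f)
    (hLip : ∀ x ∈ cube d, ∀ y ∈ cube d, f x - f y ≤ L * ‖x - y‖)
    (hest : ∀ t < T, est t ω ∈ X.confBox (5 * g) t ω)
    (hmax : ∀ t < T, ∀ p ∈ stdSimplex ℝ (Fin m), ∀ M ∈ X.confBox (5 * g) t ω,
      inner ℝ (mixture M p)
        (gradient (smoothApprox f L (smoothingParam d T)) (X.avgEst est x₀ t ω)) ≤
      inner ℝ (mixture (est t ω) (X.prob t ω))
        (gradient (smoothApprox f L (smoothingParam d T)) (X.avgEst est x₀ t ω)))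
    {p : Fin m → ℝ} (hp : p ∈ stdSimplex ℝ (Fin m)) :
    f (mixture B.mean p) - f (X.avgObs ω) ≤
      22 * (L * ‖ones d‖ * √(5 * g * m / T) + L * √(d * Real.log T / T)) := by
  have hT' : (1 : ℝ) ≤ T := by exact_mod_cast hT
  have hm' : (1 : ℝ) ≤ m := by exact_mod_cast hm
  have hμ := smoothingParam_pos hd hT
  have hμsq := smoothingParam_sq (d := d) hT
  have hμle := smoothingParam_le (d := d) hT
  set μ := smoothingParam d T
  set F := smoothApprox f L μ
  have hzc := mixture_mem_cube B.mean_mem hp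
  have hac := avgEst_mem_cube (X := X) hx₀ hest le_rfl
  have hoc := Play.avgObs_mem_cube hT hX.obs_mem
  have hfw := frankWolfe_bound (F := F) (K := L / μ) (by positivity)
    (smoothApprox_gradient_bounds hL hμ hLip) (a := fun t => X.avgEst est x₀ t ω)
    (x := fun t => mixture (est t ω) (X.prob t ω)) (z := mixture B.mean p) (T := T)
    (fun t ht => avgEst_mem_cube hx₀ hest ht.le)
    (fun t ht => mixture_mem_cube (Play.mem_Icc_of_mem_confBox (hest t ht)) (X.prob_mem t ht ω))
    (fun t _ => X.avgEst_succ est x₀ t ω)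
    (fun t ht => hmax t ht p hp _ (hX.mean_mem_confBox hg ht))
  have hharm := sum_inv_le_one_add_log T
  have hlog : 0 ≤ Real.log T := Real.log_nonneg hT'
  have hgap : F (mixture B.mean p) - F (X.avgEst est x₀ T ω) ≤ L * μ := by
    have hl2 : Real.log 2 ≤ 1 := by linarith [Real.log_two_lt_d9]
    have hl2' : 0 < Real.log 2 := Real.log_pos (by norm_num)
    -- This is what the choice of `μ` is for: the Frank–Wolfe error becomes at most the smoothing
    -- error `L μ`.
    have h1 : d * (1 + Real.log T) ≤ T * μ ^ 2 := by
      rw [hμsq]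
      have : Real.log T ≤ Real.log T / Real.log 2 := le_div_self hlog hl2' hl2
      calc d * (1 + Real.log T) ≤ d * (1 + Real.log T / Real.log 2) := by gcongr
        _ = _ := by field_simp
    have h2 : L / μ * d * ∑ t ∈ Finset.range T, ((t : ℝ) + 1)⁻¹ ≤ T * (L * μ) := by
      calc L / μ * d * ∑ t ∈ Finset.range T, ((t : ℝ) + 1)⁻¹
          ≤ L / μ * d * (1 + Real.log T) := by gcongr
        _ = L / μ * (d * (1 + Real.log T)) := by ring
        _ ≤ L / μ * (T * μ ^ 2) := by gcongr
        _ = T * (L * μ) := by field_simp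
    exact le_of_mul_le_mul_left (hfw.trans h2) (by linarith)
  have h1 : f (mixture B.mean p) ≤ F (mixture B.mean p) := le_smoothApprox hL hμ hLip hzc
  have h2 : F (X.avgEst est x₀ T ω) ≤ f (X.avgEst est x₀ T ω) + L * μ :=
    smoothApprox_le hL hμ hf hLip hac
  have h3 := hLip _ hac _ hoc
  have h4 := mul_le_mul_of_nonneg_left
    (hX.norm_avgEst_sub_avgObs_le hg hT hm (x₀ := x₀) hest) hL.le
  -- The part of `μ` without a logarithm survives at `T = 1`, so it is charged to the estimation
  -- term. Two errors `L μ` turn `20` into `22`.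
  have h5 : √((d : ℝ) / T) ≤ √d * √(5 * g * m / T) := by
    rw [← Real.sqrt_mul (Nat.cast_nonneg _)]
    refine Real.sqrt_le_sqrt ?_
    rw [mul_div_assoc']
    gcongr
    nlinarith [mul_le_mul hg hm' zero_le_one (by linarith), (Nat.cast_nonneg d : (0 : ℝ) ≤ d)]
  have h6 := mul_le_mul_of_nonneg_left (hμle.trans (add_le_add_left h5 _)) hL.le
  have h7 : 0 ≤ L * √(d * Real.log T / T) := by positivity
  rw [norm_ones]
  nlinarith

end Pathwise

/-! ### The benchmark over all policies. -/

section Optimum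

lemma Play.integrable_of_mem_Icc [IsProbabilityMeasure P] {h : Ω → ℝ} (hm : Measurable h)
    (h01 : ∀ᵐ ω ∂P, h ω ∈ Set.Icc (0 : ℝ) 1) : Integrable h P := by
  refine Integrable.of_bound hm.aestronglyMeasurable 1 ?_
  filter_upwards [h01] with ω hω
  rw [Real.norm_eq_abs, abs_of_nonneg hω.1]
  exact hω.2

lemma Play.prob_mem_Icc (X : Play B T P) {t : ℕ} (ht : t < T) (i : Fin m) (ω : Ω) :
    X.prob t ω i ∈ Set.Icc (0 : ℝ) 1 :=
  mem_Icc_of_mem_stdSimplex (X.prob_mem t ht ω) i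

lemma Play.integrable_prob [IsProbabilityMeasure P] (X : Play B T P) {t : ℕ} (ht : t < T)
    (i : Fin m) : Integrable (fun ω => X.prob t ω i) P :=
  integrable_of_mem_Icc (X.measurable_prob ht i)
    (Filter.Eventually.of_forall (X.prob_mem_Icc ht i))

/-- The arms' expected frequencies of play in round `t`. -/
def Play.meanProb (X : Play B T P) (t : ℕ) (i : Fin m) : ℝ := ∫ ω, X.prob t ω i ∂P

lemma Play.meanProb_mem [IsProbabilityMeasure P] (X : Play B T P) {t : ℕ} (ht : t < T) :
    X.meanProb t ∈ stdSimplex ℝ (Fin m) := by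
  refine ⟨fun i => integral_nonneg fun ω => (X.prob_mem_Icc ht i ω).1, ?_⟩
  simp only [Play.meanProb]
  rw [← integral_finsetSum _ fun i _ => X.integrable_prob ht i]
  simp [(X.prob_mem t ht _).2]

lemma Play.integral_obs_coord [IsProbabilityMeasure P] (X : Play B T P) {t : ℕ} (ht : t < T)
    (j : Fin d) : ∫ ω, X.obs t ω j ∂P = mixture B.mean (X.meanProb t) j := by
  have hmem := X.ae_obs_mem_cube ht
  rw [integral_eq_lintegral_of_nonneg_ae (hmem.mono fun ω hω => (hω j).1)
    ((measurable_coord j).comp (X.measurable_obs ht)).aestronglyMeasurable]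
  have h := X.lintegral_mul_arm_obs ht (h := fun _ _ => 1) (fun _ => measurable_const)
    (ψ := fun _ v => ENNReal.ofReal (v j)) (fun _ => (measurable_coord j).ennreal_ofReal)
  simp only [one_mul] at h
  rw [h, mixture_apply]
  have e : ∀ i, (∫⁻ ω, ENNReal.ofReal (X.prob t ω i) ∂P) *
      ∫⁻ v, ENNReal.ofReal (v j) ∂(B.law i) =
      ENNReal.ofReal (X.meanProb t i * B.mean j i) := by
    intro i
    rw [ENNReal.ofReal_mul ((X.meanProb_mem ht).1 i), Play.meanProb, Instance.mean,
      ofReal_integral_eq_lintegral_ofReal (X.integrable_prob ht i)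
        (Filter.Eventually.of_forall fun ω => (X.prob_mem_Icc ht i ω).1),
      ofReal_integral_eq_lintegral_ofReal (B.integrable_coord i j)
        ((B.ae_coord_mem i j).mono fun v hv => hv.1)]
  simp_rw [e]
  have hnn : ∀ i ∈ Finset.univ, 0 ≤ X.meanProb t i * B.mean j i := fun i _ =>
    mul_nonneg ((X.meanProb_mem ht).1 i) (B.mean_mem j i).1
  rw [← ENNReal.ofReal_sum_of_nonneg hnn, ENNReal.toReal_ofReal (Finset.sum_nonneg hnn)]

lemma Play.measurable_avgObs (X : Play B T P) : Measurable X.avgObs :=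
  Measurable.const_smul (g := fun ω => ∑ t ∈ Finset.range T, X.obs t ω)
    (Finset.measurable_sum _ fun _ hs => X.measurable_obs (Finset.mem_range.1 hs)) (T : ℝ)⁻¹

lemma Play.ae_avgObs_mem_cube (X : Play B T P) (hT : 0 < T) : ∀ᵐ ω ∂P, X.avgObs ω ∈ cube d :=
  X.ae_forall_obs_mem_cube.mono fun ω hω => Play.avgObs_mem_cube hT hω

lemma Play.integrable_avgObs [IsProbabilityMeasure P] (X : Play B T P) (hT : 0 < T) :
    Integrable X.avgObs P := by
  refine Integrable.of_bound X.measurable_avgObs.aestronglyMeasurable √d ?_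
  exact (X.ae_avgObs_mem_cube hT).mono fun ω hω => norm_le_of_mem_cube hω

/-- Adaptivity disappears in expectation: each round contributes `V` times its mean play
distribution, and the simplex is convex. -/
lemma Play.exists_integral_avgObs_eq [IsProbabilityMeasure P] (X : Play B T P) (hT : 0 < T) :
    ∃ p ∈ stdSimplex ℝ (Fin m), ∫ ω, X.avgObs ω ∂P = mixture B.mean p := by
  refine ⟨(T : ℝ)⁻¹ • ∑ t ∈ Finset.range T, X.meanProb t,
    average_mem (convex_stdSimplex ℝ _) hT fun t ht => X.meanProb_mem ht, ?_⟩
  ext j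
  have h1 : (∫ ω, X.avgObs ω ∂P) j = ∫ ω, X.avgObs ω j ∂P :=
    ((EuclideanSpace.proj (𝕜 := ℝ) j).integral_comp_comm (X.integrable_avgObs hT)).symm
  have h2 : ∀ ω, X.avgObs ω j = (T : ℝ)⁻¹ * ∑ t ∈ Finset.range T, X.obs t ω j := fun ω => by
    simp [Play.avgObs]
  rw [h1]
  simp_rw [h2]
  rw [integral_const_mul, integral_finsetSum]
  · rw [Finset.sum_congr rfl fun t ht => X.integral_obs_coord (Finset.mem_range.1 ht) j]
    simp_rw [mixture_apply]
    rw [Finset.sum_comm, Finset.mul_sum]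
    refine Finset.sum_congr rfl fun i _ => ?_
    simp only [Pi.smul_apply, Finset.sum_apply, smul_eq_mul]
    rw [mul_assoc, Finset.sum_mul]
  · intro t ht
    have ht := Finset.mem_range.1 ht
    exact Play.integrable_of_mem_Icc ((measurable_coord j).comp (X.measurable_obs ht))
      ((X.ae_obs_mem_cube ht).mono fun ω hω => hω j)

lemma continuousOn_of_lipschitz {f : Vec d → ℝ} {L : ℝ} (hL : 0 < L)
    (hLip : ∀ x ∈ cube d, ∀ y ∈ cube d, f x - f y ≤ L * ‖x - y‖) : ContinuousOn f (cube d) := by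
  have : LipschitzOnWith (Real.toNNReal L) f (cube d) := by
    refine LipschitzOnWith.of_le_add_mul _ fun x hx y hy => ?_
    rw [Real.coe_toNNReal _ hL.le, dist_eq_norm]
    linarith [hLip x hx y hy]
  exact this.continuousOn

/-- By Jensen's inequality no policy does better than the best fixed distribution. -/
lemma optValue_le (hT : 0 < T) {f : Vec d → ℝ} {L : ℝ} (hL : 0 < L)
    (hf : ConcaveOn ℝ (cube d) f) (hf01 : ∀ x ∈ cube d, f x ∈ Set.Icc (0 : ℝ) 1)
    (hLip : ∀ x ∈ cube d, ∀ y ∈ cube d, f x - f y ≤ L * ‖x - y‖) {r : ℝ} (hr : 0 ≤ r)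
    (h : ∀ p ∈ stdSimplex ℝ (Fin m), f (mixture B.mean p) ≤ r) : optValue B T f ≤ r := by
  -- The assumption `0 ≤ r` replaces nonemptiness, so no policy has to be constructed.
  refine Real.sSup_le ?_ hr
  rintro _ ⟨Ω', _, P', _, Y, rfl⟩
  have hY := Y.ae_avgObs_mem_cube hT
  have hc := continuousOn_of_lipschitz hL hLip
  obtain ⟨p, hp, he⟩ := Y.exists_integral_avgObs_eq hT
  have hfi : Integrable (f ∘ Y.avgObs) P' := by
    -- Nothing is known about `f` off the cube, so measurability is taken from its indicator
    -- version.
    have hmeas : Measurable ((cube d).indicator f) := by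
      classical
      exact hc.measurable_piecewise continuousOn_const (isClosed_cube d).measurableSet
    refine (Play.integrable_of_mem_Icc (hmeas.comp Y.measurable_avgObs) ?_).congr ?_
    · filter_upwards [hY] with ω hω
      simpa [Set.indicator_of_mem hω] using hf01 _ hω
    · filter_upwards [hY] with ω hω
      simp [Set.indicator_of_mem hω]
  have hj := hf.le_map_integral hc (isClosed_cube d) hY (Y.integrable_avgObs hT) hfi
  exact (hj.trans_eq (congrArg f he)).trans (h p hp)

end Optimum

/-! ### From typical outcomes to the probability statements. -/

section Runs

variable [IsProbabilityMeasure P]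

/-- Almost every failure of `Q` is atypical. Subadditivity over a set and its complement then gives
the lower bound without measurability of `Q`. -/
lemma le_measure_of_typical {X : Play B T P} {est : ℕ → Ω → Matrix (Fin d) (Fin m) ℝ} {g δ : ℝ}
    {F : Vec d → ℝ} {x₀ : Vec d} {Q : Ω → Prop} (hδ0 : 0 ≤ δ)
    (hδ : (2 * m * d * T * T + 2 * d + 1) * Real.exp (-g) ≤ δ)
    (hrun : IsPrimalRun X est (5 * g) F x₀)
    (hQ : ∀ ω, X.IsTypical g (5 * g) ω → (∀ t < T, est t ω ∈ X.confBox (5 * g) t ω) →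
      (∀ t < T, ∀ p ∈ stdSimplex ℝ (Fin m), ∀ M ∈ X.confBox (5 * g) t ω,
        inner ℝ (mixture M p) (gradient F (X.avgEst est x₀ t ω)) ≤
          inner ℝ (mixture (est t ω) (X.prob t ω)) (gradient F (X.avgEst est x₀ t ω))) → Q ω) :
    ENNReal.ofReal (1 - δ) ≤ P {ω | Q ω} := by
  have h1 : ∀ᵐ ω ∂P, ∀ t < T, est t ω ∈ X.confBox (5 * g) t ω :=
    ae_all_iff.2 fun t => ae_all_iff.2 (hrun.est_mem t)
  have h2 := ae_all_iff.2 fun t => ae_all_iff.2 (hrun.maximal t)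
  have hbad : P {ω | Q ω}ᶜ ≤ ENNReal.ofReal δ := by
    refine le_trans (measure_mono_ae ?_)
      ((X.measure_not_isTypical_le g (5 * g)).trans (ENNReal.ofReal_le_ofReal hδ))
    filter_upwards [h1, h2] with ω a1 a2 (hω : ¬ Q ω)
    exact fun ht => hω (hQ ω ht a1 a2)
  have huniv := measure_univ_le_add_compl (μ := P) {ω | Q ω}
  rw [measure_univ] at huniv
  rw [ENNReal.ofReal_sub _ hδ0, ENNReal.ofReal_one]
  exact tsub_le_iff_right.2 (huniv.trans (add_le_add_right hbad _))

end Runs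

lemma concaveOn_neg_infDist {S : Set (Vec d)} (hS : Convex ℝ S) (hne : S.Nonempty) :
    ConcaveOn ℝ (cube d) fun z => -Metric.infDist z S := by
  refine ⟨convex_cube d, fun x _ y _ a b ha hb hab => ?_⟩
  simp only [smul_eq_mul]
  suffices h : Metric.infDist (a • x + b • y) S ≤
      a * Metric.infDist x S + b * Metric.infDist y S by linarith
  -- The set `S` need not be closed, so near-minimizers stand in for nearest points.
  refine le_of_forall_pos_le_add fun ε hε => ?_
  obtain ⟨u, hu, hxu⟩ := (Metric.infDist_lt_iff hne).1 (lt_add_of_pos_right (Metric.infDist x S) hε)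
  obtain ⟨v, hv, hyv⟩ := (Metric.infDist_lt_iff hne).1 (lt_add_of_pos_right (Metric.infDist y S) hε)
  calc Metric.infDist (a • x + b • y) S
      ≤ dist (a • x + b • y) (a • u + b • v) :=
        Metric.infDist_le_dist_of_mem (hS hu hv ha hb hab)
    _ ≤ dist (a • x) (a • u) + dist (b • y) (b • v) := dist_add_add_le _ _ _ _
    _ = a * dist x u + b * dist y v := by
        rw [dist_smul₀, dist_smul₀, Real.norm_of_nonneg ha, Real.norm_of_nonneg hb]
    _ ≤ a * (Metric.infDist x S + ε) + b * (Metric.infDist y S + ε) := by gcongr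
    _ = a * Metric.infDist x S + b * Metric.infDist y S + (a + b) * ε := by ring
    _ = _ := by rw [hab, one_mul]

end Bandit
end

theorem theorem6 :
    ∃ c₀ C : ℝ, 0 < c₀ ∧ 0 < C ∧
      ∀ (m d T : ℕ), 2 ≤ m * T * d →
      ∀ δ : ℝ, 0 < δ → δ < 1 →
      ∀ c : ℝ, c₀ ≤ c →
      ∀ γ : ℝ, γ = c * Real.log ((m : ℝ) * T * d / δ) →
      ∀ (B : Bandit.Instance m d) (x₀ : Bandit.Vec d), x₀ ∈ Bandit.cube d →
      ∀ (Ω : Type*) [MeasurableSpace Ω] (P : MeasureTheory.Measure Ω)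
        [MeasureTheory.IsProbabilityMeasure P]
        (X : Bandit.Play B T P) (est : ℕ → Ω → Matrix (Fin d) (Fin m) ℝ),
      (∀ (f : Bandit.Vec d → ℝ) (L : ℝ), 0 < L →
        ConcaveOn ℝ (Bandit.cube d) f →
        (∀ x ∈ Bandit.cube d, f x ∈ Set.Icc (0 : ℝ) 1) →
        (∀ x ∈ Bandit.cube d, ∀ y ∈ Bandit.cube d, f x - f y ≤ L * ‖x - y‖) →
        Bandit.IsPrimalRun X est γ
          (Bandit.smoothApprox f L (Bandit.smoothingParam d T)) x₀ →
        ENNReal.ofReal (1 - δ) ≤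
          P {ω | Bandit.regretObj X f ω ≤
            C * (L * ‖Bandit.ones d‖ * √(γ * m / T) + L * √(d * Real.log T / T))}) ∧
      (∀ S : Set (Bandit.Vec d), Convex ℝ S →
        (∃ p ∈ stdSimplex ℝ (Fin m), Bandit.mixture B.mean p ∈ S) →
        Bandit.IsPrimalRun X est γ
          (Bandit.smoothApprox (fun z => -Metric.infDist z S) 1 (Bandit.smoothingParam d T)) x₀ →
        ENNReal.ofReal (1 - δ) ≤
          P {ω | Bandit.regretCon X S ω ≤
            C * (‖Bandit.ones d‖ * √(γ * m / T) + √(d * Real.log T / T))}) := by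
  refine ⟨25, 22, by norm_num, by norm_num, ?_⟩
  intro m d T hn δ hδ hδ1 c hc γ hγ B x₀ hx₀ Ω _ P _ X est
  have hpos : 0 < m * T * d := by omega
  have hd : 0 < d := Nat.pos_of_ne_zero (by rintro rfl; simp at hpos)
  have hT : 0 < T := Nat.pos_of_ne_zero (by rintro rfl; simp at hpos)
  have hm : 0 < m := Nat.pos_of_ne_zero (by rintro rfl; simp at hpos)
  -- The exponent `g` of the tail bounds is a fifth of `γ`, as `abs_sub_le_two_rad` requires.
  obtain ⟨g, rfl⟩ : ∃ g, γ = 5 * g := ⟨γ / 5, by ring⟩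
  obtain ⟨hg, hunion⟩ := Bandit.union_bound_le hn hδ hδ1 hc (g := g) (by rw [← hγ]; ring)
  constructor
  · intro f L hL hf hf01 hLip hrun
    refine Bandit.le_measure_of_typical hδ.le hunion hrun fun ω hX hest hmax => ?_
    rw [Bandit.regretObj, sub_le_iff_le_add]
    refine Bandit.optValue_le hT hL hf hf01 hLip ?_ fun p hp => ?_
    · have := (hf01 _ (Bandit.Play.avgObs_mem_cube hT hX.obs_mem)).1
      positivity
    · rw [← sub_le_iff_le_add]
      exact hX.regret_le hg hT hm hd hx₀ hL hf hLip hest hmax hp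
  · rintro S hS ⟨p, hp, hpS⟩ hrun
    have hLip : ∀ x ∈ Bandit.cube d, ∀ y ∈ Bandit.cube d,
        -Metric.infDist x S - -Metric.infDist y S ≤ 1 * ‖x - y‖ := by
      intro x _ y _
      have := Metric.infDist_le_infDist_add_dist (s := S) (x := y) (y := x)
      rw [dist_comm, dist_eq_norm] at this
      linarith
    refine Bandit.le_measure_of_typical hδ.le hunion hrun fun ω hX hest hmax => ?_
    -- The comparator `V p` lies in `S`, so its value is zero and the regret is the distance itself.
    have h := hX.regret_le hg hT hm hd hx₀ one_pos
      (Bandit.concaveOn_neg_infDist hS ⟨_, hpS⟩) hLip hest hmax hp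
    simp only [Metric.infDist_zero_of_mem hpS, one_mul] at h
    rw [Bandit.regretCon]
    linarith
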